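/- Let $p,k\ge 1$ be integers and consider the word $W^k$ of length $2pk$, where $W=1\,2\cdots p\,p^*\cdots 2^*1^*$. Its positions $1,\dots,2pk$ are called legs. Let $u_1,\dots,u_p$ be pairwise different labels; the letters $i$ and $i^*$ both carry the label $u_i$. A leg with letter $i$ has preceding color $i$ and following color $i+1$; a leg with letter $i^*$ has preceding color $i+1$ and following color $i$ (colors lie in $\{1,\dots,p+1\}$). Let $\mathcal{NC}(W^k)$ be the set of noncrossing partitions $\pi$ of $\{1,\dots,2pk\}$ such that, for every block $V$ of $\pi$, (i) all legs of $V$ carry the same label, denoted $u_V$, and (ii) the color preceding the first leg of $V$ equals the color following the last leg of $V$. For a block $V=\{s_1<\dots<s_m\}$ put $d(V)=d_{i_1}d_{i_2}\cdots d_{i_{m-1}}$, where $i_l$ is the color following the leg $s_l$, and let $d(\pi)=\prod_{V\in\pi}d(V)$, a monomial in the variables $d_1,\dots,d_{p+1}$. Let $K\subseteq\{1,\dots,p\}$ with $|K|=q$. For $i\in K$ let $\nu_i$ be the standard free Poisson (Marchenko–Pastur) law, with density $\frac{\sqrt{x(4-x)}}{2\pi x}$ on $[0,4]$; for $i\notin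 K$ let $\nu_i$ be the standard Wigner semicircle law, with density $\frac{\sqrt{4-x^2}}{2\pi}$ on $[-2,2]$. Let $(r_n(u_i))_{n\ge1}$ be the free cumulants of $\nu_i$, that is, the coefficients of the formal power series $R(z)=\sum_{n\ge1}r_n(u_i)z^n$ determined by $R(zM(z))=M(z)-1$, where $M(z)=\sum_{n\ge 0}z^n\int x^n\,d\nu_i(x)$. For $\boldsymbol j=(j_1,\dots,j_{p+1})$ with nonnegative integer entries define $$N_k(\boldsymbol j)=\sum_{\substack{\pi\in\mathcal{NC}(W^k)\\ d(\pi)=d_1^{j_1}\cdots d_{p+1}^{j_{p+1}}}}\ \prod_{V\in\pi}r_{|V|}(u_V),$$ where an empty sum is $0$. **Proposition 6.1.** For all $k\ge1$ and all $\boldsymbol j$, $$N_k(\boldsymbol j)=\frac1k\binom{k}{j_1+1}\binom{k}{j_2}\cdots\binom{k}{j_{p+1}}\binom{kq}{|\boldsymbol j|-kp},$$ where $|\boldsymbol j|=j_1+\dots+j_{p+1}$ and $\binom ab=0$ unless $0\le b\le a$. -/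

import Mathlib

open MeasureTheory

noncomputable section

namespace FussNarayana

/-! ### Laws and free cumulants -/

/-- The standard Wigner semicircle law, with density `√(4 - x²) / (2π)` on `[-2, 2]`. -/
def semicircleLaw : Measure ℝ :=
  (volume.restrict (Set.Icc (-2) 2)).withDensity
    fun x => ENNReal.ofReal (√(4 - x ^ 2) / (2 * Real.pi))

/-- The standard free Poisson (Marchenko-Pastur, shape `1`) law, with density
`√(x (4 - x)) / (2πx)` on `[0, 4]`. -/
def freePoissonLaw : Measure ℝ :=
  (volume.restrict (Set.Icc 0 4)).withDensity
    fun x => ENNReal.ofReal (√(x * (4 - x)) / (2 * Real.pi * x))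

/-- The free cumulants `r₁, r₂, …` of a distribution with moments `m₀ = 1, m₁, m₂, …`,
that is, the coefficients of its R-series `R(z) = ∑_{n ≥ 1} rₙ zⁿ`. With `M(z) = ∑ₙ mₙ zⁿ`,
the R-series is determined by `R(z M(z)) = M(z) - 1`, i.e. by
`mₙ = ∑_{s=1}^{n} r_s [z^{n-s}] M(z)^s` for `n ≥ 1`; this is solved recursively for `rₙ`.
The value at `0` is not a free cumulant and is set to `0`. -/
def freeCumulantOfMoments (m : ℕ → ℝ) (n : ℕ) : ℝ :=
  if n = 0 then 0
  else m n - ∑ s : Fin n, freeCumulantOfMoments m s *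
    PowerSeries.coeff (n - s) (PowerSeries.mk m ^ (s : ℕ))
termination_by n
decreasing_by exact s.2

/-- The free cumulants of a probability measure on the real line all of whose moments exist. -/
def freeCumulant (ν : Measure ℝ) (n : ℕ) : ℝ :=
  freeCumulantOfMoments (fun l => ∫ x, x ^ l ∂ν) n

/-! ### The word `W^k`, `W = 1 2 ⋯ p p* ⋯ 2* 1*`

Letters, legs and colors are numbered from `0`: the letter `i ∈ {1, …, p}` is
`i - 1 : Fin p`, the color `i ∈ {1, …, p + 1}` is `i - 1 : Fin (p + 1)`, and the leg
`s ∈ {1, …, 2pk}` is `s - 1 : Fin (2 * p * k)`. -/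

/-- A letter `i` (second component `false`) or `i*` (second component `true`). -/
abbrev Letter (p : ℕ) := Fin p × Bool

/-- The letter of the word `W^k` at leg `s`. -/
def wordLetter (p k : ℕ) (s : Fin (2 * p * k)) : Letter p :=
  if h : (s : ℕ) % (2 * p) < p then (⟨(s : ℕ) % (2 * p), h⟩, false)
  else (⟨2 * p - 1 - (s : ℕ) % (2 * p), by
    have hp : 0 < p := Nat.pos_of_ne_zero fun h0 => by subst h0; exact absurd s.2 (by simp)
    omega⟩, true)

/-- The color of the segment which starts at a leg carrying the given letter:
`i + 1` for the letter `i`, and `i` for the letter `i*`. -/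
def colorAfter {p : ℕ} : Letter p → Fin (p + 1)
  | (i, false) => i.succ
  | (i, true) => i.castSucc

/-- The color which immediately precedes a letter in the color sequence
`1 2 ⋯ p (p+1) p ⋯ 2 1 2 ⋯ 1` (a periodic Catalan path) of the one-block partition, extended by
`1` at both ends: `i` for the letter `i`, and `i + 1` for the letter `i*`. -/
def colorBefore {p : ℕ} : Letter p → Fin (p + 1)
  | (i, false) => i.castSucc
  | (i, true) => i.succ

/-! ### Adapted noncrossing partitions -/

/-- `π` is noncrossing: there are no `a < b < c < d` with `a, c` in one block and `b, d` in
another block. -/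
def IsNoncrossing {n : ℕ} (π : Finpartition (Finset.univ : Finset (Fin n))) : Prop :=
  ∀ V ∈ π.parts, ∀ V' ∈ π.parts, ∀ a b c d : Fin n, a < b → b < c → c < d →
    a ∈ V → c ∈ V → b ∈ V' → d ∈ V' → V = V'

/-- `π` is label adapted to `W^k`: the letters of all legs of a block have the same label. The
letters `i` and `i*` both have the label `u i`. -/
def IsLabelAdapted {U : Type*} (p k : ℕ) (u : Fin p → U)
    (π : Finpartition (Finset.univ : Finset (Fin (2 * p * k)))) : Prop :=
  ∀ V ∈ π.parts, ∀ s ∈ V, ∀ t ∈ V, u (wordLetter p k s).1 = u (wordLetter p k t).1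

/-- `π` is color adapted to `W^k`: in the noncrossing bracketing of the color sequence given by
`π`, each pair of brackets has identical neighbors. The brackets of a block `V` stand at its
first leg and at its last leg, so the color just before the first leg of `V` has to be the color
just after the last leg of `V`. -/
def IsColorAdapted (p k : ℕ)
    (π : Finpartition (Finset.univ : Finset (Fin (2 * p * k)))) : Prop :=
  ∀ V (hV : V ∈ π.parts),
    colorBefore (wordLetter p k (V.min' (π.nonempty_of_mem_parts hV))) =
      colorAfter (wordLetter p k (V.max' (π.nonempty_of_mem_parts hV)))

open scoped Classical in
/-- The set `NC(W^k)` of noncrossing partitions of the `2pk` legs which are adapted to `W^k`,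
that is, both color adapted and label adapted. -/
def adaptedNC {U : Type*} (p k : ℕ) (u : Fin p → U) :
    Finset (Finpartition (Finset.univ : Finset (Fin (2 * p * k)))) :=
  {π | IsNoncrossing π ∧ IsColorAdapted p k π ∧ IsLabelAdapted p k u π}

/-- The exponent of the variable `d_i` in the monomial `d(V)`, the product of `d_c` over the
colors `c` of the segments of `V`. The segments of `V` start at all legs of `V` but the last. -/
def blockDimExponent (p k : ℕ) (V : Finset (Fin (2 * p * k))) (i : Fin (p + 1)) : ℕ :=
  (V.filter fun s => (∃ t ∈ V, s < t) ∧ colorAfter (wordLetter p k s) = i).card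

/-- The exponents of the monomial `d(π)`, the product of `d(V)` over all blocks `V` of `π`. -/
def dimExponent (p k : ℕ) (π : Finpartition (Finset.univ : Finset (Fin (2 * p * k)))) :
    Fin (p + 1) → ℕ :=
  fun i => ∑ V ∈ π.parts, blockDimExponent p k V i

open scoped Classical in
/-- The set `NC_j(W^k)` of all `π` in `NC(W^k)` with `d(π) = ∏ᵢ d_i ^ j_i`. -/
def adaptedNCWithDim {U : Type*} (p k : ℕ) (u : Fin p → U) (j : Fin (p + 1) → ℕ) :
    Finset (Finpartition (Finset.univ : Finset (Fin (2 * p * k)))) :=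
  {π ∈ adaptedNC p k u | dimExponent p k π = j}

/-- The weighted count `N_k(j) = ∑_{π ∈ NC_j(W^k)} ∏_{V ∈ π} r_{|V|}(u_V)`, where `r_n(a)` is
the `n`-th free cumulant of the law `ν a` with label `a`, and `u_V` is the common label of the
legs of `V` (read off at its first leg). -/
def weightedCount {U : Type*} (p k : ℕ) (u : Fin p → U) (ν : U → Measure ℝ)
    (j : Fin (p + 1) → ℕ) : ℝ :=
  ∑ π ∈ adaptedNCWithDim p k u j, ∏ V ∈ π.parts.attach,
    freeCumulant
      (ν (u (wordLetter p k (V.1.min' (π.nonempty_of_mem_parts V.2))).1)) V.1.card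

/-- The binomial coefficient with an integer lower index, equal to `0` unless `0 ≤ b ≤ a`. -/
def binom (a : ℕ) (b : ℤ) : ℕ :=
  if 0 ≤ b then a.choose b.toNat else 0

end FussNarayana

end

/-!
# Weighted counts of adapted noncrossing partitions

The free cumulants of the free Poisson law are all `1`, and the only nonzero one of the semicircle
law is the second (`freeCumulant_freePoissonLaw`, `freeCumulant_semicircleLaw`; both follow from
the quadratic equation for the Catalan generating function). So, with `d(π)` as a monomial in
`MvPolynomial`, `N_k` is the coefficient of `d^j` in a sum over noncrossing partitions of a
product of block weights (`weightedCount_eq_coeff`).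

Such a sum over the partitions of an interval `[a, b)` splits at the successor `t` of `a` in its
block, into a sum over `[a + 1, t)` and one over `[t, b)` (`rootedSum_of_lt`). By induction, the
stretch between consecutive legs of a block starts and ends at the same color. Hence the letters
of a block alternate between `i` and `i*`, and for both laws the total weights `Z(a, b)` of the
infinite word `W W W ⋯` satisfy the recursion `wordSum_of_lt`, where the two laws differ only in
whether a block may be continued after its second leg.

As `Z` is `2p`-periodic, the recursion becomes a system of equations between power series in `z`,
where `z` marks the periods (`loopGF_eq`, `mirrorGF_eq`). Write `-e` for the mirror image of the
position `e` modulo `2p`, where the same color occurs with the path running in the opposite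
direction, `Y_e` for the series of the stretches from `e` to `-e`, and `F_e` for those from `e` to
`e`. Let `x` be the weight `d_c d_{c+1} Y_{e+1} Y_{-e}` of one turn of a block of label `c`, and let
`κ` be `1` or `0` according to the law. Then `d_c (F_e - 1) (1 - κ x) = x`. Since `x` and `κ` are
the same for a leg and its mirror image, and `F_e = F_{-e}`, the series `P = d_c (F_e - 1)` is the
same for all colors (`scaledLoopGF_eq`), and `x (1 + κ P) = P`. Moreover
`Y_e Y_{-e} = F_e (F_e - 1)`, so the product of the turn weights over all labels telescopes
(`prod_turnGF`), which gives `P = z (1 + P)^q ∏_c (d_c + P)`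
(`scaledLoopGF_functional_equation`). Lagrange inversion (`lagrange_inversion`) and the binomial
theorem now give the coefficients of `P`, and `[z^k] P = d_0 Z(0, 2pk)`.
-/

namespace FussNarayana

open Finset

/-! ### Moments and free cumulants -/

theorem integral_sin_pow_two_mul_half {a : ℝ} (ha : Real.sin a * Real.cos a = 0) (n : ℕ) :
    ∫ θ in a..(Real.pi / 2), Real.sin θ ^ (2 * n) =
      (Real.pi / 2 - a) * ((n.centralBinom : ℝ) / 4 ^ n) := by
  induction n with
  | zero => simp
  | succ n ih =>
    have h0 : Real.sin a ^ (2 * n + 1) * Real.cos a = 0 := by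
      rw [pow_succ, mul_assoc, ha, mul_zero]
    have hb : ((n : ℝ) + 1) * ((n + 1).centralBinom : ℝ) =
        2 * (2 * n + 1) * (n.centralBinom : ℝ) := by
      exact_mod_cast Nat.succ_mul_centralBinom_succ n
    have hb' : ((n + 1).centralBinom : ℝ) = 2 * (2 * n + 1) * (n.centralBinom : ℝ) / (n + 1) := by
      field_simp; linarith
    rw [show 2 * (n + 1) = 2 * n + 2 by ring, integral_sin_pow, h0, Real.cos_pi_div_two, ih, hb']
    push_cast
    field_simp
    ring

theorem integral_sin_pow_odd_symm (n : ℕ) :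
    ∫ θ in (-(Real.pi / 2))..(Real.pi / 2), Real.sin θ ^ (2 * n + 1) = 0 := by
  induction n with
  | zero => simp
  | succ n ih =>
    rw [show 2 * (n + 1) + 1 = (2 * n + 1) + 2 by ring, integral_sin_pow, ih]
    simp

/-- The substitution `y = 2 sin θ`. The condition on `a` makes the boundary terms of the reduction
formula vanish; it is used for `a = 0` and `a = -π / 2`. -/
theorem integral_pow_mul_sqrt {a : ℝ} (ha : Real.sin a * Real.cos a = 0)
    (h1 : -(Real.pi / 2) ≤ a) (h2 : a ≤ Real.pi / 2) (n : ℕ) :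
    ∫ y in (2 * Real.sin a)..2, y ^ n * √(4 - y ^ 2) =
      4 * 2 ^ n / (n + 2) * ∫ θ in a..(Real.pi / 2), Real.sin θ ^ n := by
  have hs : ∫ y in (2 * Real.sin a)..2, y ^ n * √(4 - y ^ 2) =
      ∫ θ in a..(Real.pi / 2), ((2 * Real.sin θ) ^ n * √(4 - (2 * Real.sin θ) ^ 2)) *
        (2 * Real.cos θ) := by
    have := intervalIntegral.integral_comp_mul_deriv (a := a) (b := Real.pi / 2)
      (f := fun θ => 2 * Real.sin θ) (f' := fun θ => 2 * Real.cos θ)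
      (g := fun y => y ^ n * √(4 - y ^ 2))
      (fun x _ => (Real.hasDerivAt_sin x).const_mul 2) (by fun_prop) (by fun_prop)
    simpa using this.symm
  have hc : ∀ θ ∈ Set.uIcc a (Real.pi / 2),
      ((2 * Real.sin θ) ^ n * √(4 - (2 * Real.sin θ) ^ 2)) * (2 * Real.cos θ) =
        4 * 2 ^ n * (Real.sin θ ^ n - Real.sin θ ^ (n + 2)) := by
    intro θ hθ
    rw [Set.uIcc_of_le h2] at hθ
    have hcos : 0 ≤ Real.cos θ := Real.cos_nonneg_of_mem_Icc ⟨h1.trans hθ.1, hθ.2⟩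
    have : (4 - (2 * Real.sin θ) ^ 2) = (2 * Real.cos θ) ^ 2 := by
      have := Real.sin_sq_add_cos_sq θ
      linarith
    rw [this, Real.sqrt_sq (by positivity), mul_pow, pow_add, Real.sin_sq θ]
    ring
  have h0 : Real.sin a ^ (n + 1) * Real.cos a = 0 := by
    rw [pow_succ, mul_assoc, ha, mul_zero]
  rw [hs, intervalIntegral.integral_congr hc, intervalIntegral.integral_const_mul,
    intervalIntegral.integral_sub (Continuous.intervalIntegrable (by fun_prop) _ _)
      (Continuous.intervalIntegrable (by fun_prop) _ _), integral_sin_pow, h0,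
    Real.cos_pi_div_two]
  field_simp
  ring

/-- The even moments of the semicircle law are the Catalan numbers, the odd ones vanish. -/
theorem integral_pow_semicircleLaw (n : ℕ) :
    ∫ x, x ^ n ∂semicircleLaw = if 2 ∣ n then (catalan (n / 2) : ℝ) else 0 := by
  have h : ∫ x, x ^ n ∂semicircleLaw =
      1 / (2 * Real.pi) * ∫ y in (2 * Real.sin (-(Real.pi / 2)))..2, y ^ n * √(4 - y ^ 2) := by
    rw [semicircleLaw, integral_withDensity_eq_integral_toReal_smul (by fun_prop)
      (by simp), Real.sin_neg, Real.sin_pi_div_two,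
      intervalIntegral.integral_of_le (by norm_num), ← integral_Icc_eq_integral_Ioc,
      ← integral_const_mul]
    norm_num
    congr 1
    ext x
    rw [ENNReal.toReal_ofReal (by positivity)]
    field_simp
  rw [h, integral_pow_mul_sqrt (by simp) le_rfl (by linarith [Real.pi_pos])]
  split_ifs with h2
  · obtain ⟨l, rfl⟩ := h2
    rw [integral_sin_pow_two_mul_half (by simp), Nat.mul_div_cancel_left _ (by norm_num),
      catalan_eq_centralBinom_div, Nat.cast_div (Nat.succ_dvd_centralBinom l) (by positivity)]
    have h4 : (2 : ℝ) ^ (2 * l) = 4 ^ l := by rw [pow_mul]; norm_num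
    rw [h4]
    have := Real.pi_pos
    push_cast
    field_simp
    ring
  · obtain ⟨l, rfl⟩ : ∃ l, n = 2 * l + 1 := ⟨n / 2, by omega⟩
    rw [integral_sin_pow_odd_symm]
    simp

/-- The moments of the free Poisson law are the Catalan numbers: the substitution `x = y ^ 2`
turns its density into twice that of the semicircle law on `[0, 2]`. -/
theorem integral_pow_freePoissonLaw (n : ℕ) :
    ∫ x, x ^ n ∂freePoissonLaw = (catalan n : ℝ) := by
  have h : ∫ x, x ^ n ∂freePoissonLaw =
      1 / Real.pi * ∫ y in (2 * Real.sin 0)..2, y ^ (2 * n) * √(4 - y ^ 2) := by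
    have him : (fun y : ℝ => y ^ 2) '' Set.Ioo 0 2 = Set.Ioo 0 4 := by
      ext x
      constructor
      · rintro ⟨y, ⟨h0, h2⟩, rfl⟩
        exact ⟨by positivity, by dsimp only; nlinarith⟩
      · rintro ⟨h0, h4⟩
        refine ⟨√x, ⟨Real.sqrt_pos.2 h0, ?_⟩, Real.sq_sqrt h0.le⟩
        rw [Real.sqrt_lt' (by norm_num)]
        linarith
    have hinj : Set.InjOn (fun y : ℝ => y ^ 2) (Set.Ioo 0 2) := by
      intro x hx y hy hxy
      exact (pow_left_inj₀ hx.1.le hy.1.le two_ne_zero).1 hxy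
    rw [freePoissonLaw, integral_withDensity_eq_integral_toReal_smul (by fun_prop)
      (by simp), Real.sin_zero, mul_zero,
      intervalIntegral.integral_of_le (by norm_num), integral_Icc_eq_integral_Ioo,
      integral_Ioc_eq_integral_Ioo, ← him,
      integral_image_eq_integral_abs_deriv_smul measurableSet_Ioo
        (f' := fun y => 2 * y) (fun x _ => by
          simpa using (hasDerivAt_pow 2 x).hasDerivWithinAt) hinj, ← integral_const_mul]
    refine setIntegral_congr_fun measurableSet_Ioo fun y hy => ?_
    have hy0 : 0 < y := hy.1
    have hs : √(y ^ 2 * (4 - y ^ 2)) = y * √(4 - y ^ 2) := by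
      rw [Real.sqrt_mul (by positivity), Real.sqrt_sq hy0.le]
    simp only [smul_eq_mul]
    rw [ENNReal.toReal_ofReal (by positivity), abs_of_pos (by positivity), hs, ← pow_mul]
    field_simp
  rw [h, integral_pow_mul_sqrt (by simp) (by linarith [Real.pi_pos]) (by linarith [Real.pi_pos]),
    integral_sin_pow_two_mul_half (by simp),
    catalan_eq_centralBinom_div, Nat.cast_div (Nat.succ_dvd_centralBinom n) (by positivity)]
  have h4 : (2 : ℝ) ^ (2 * n) = 4 ^ n := by rw [pow_mul]; norm_num
  rw [h4]
  have := Real.pi_pos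
  push_cast
  field_simp
  ring

/-- The relation `R(z M(z)) = M(z) - 1` characterizes the free cumulants. -/
theorem freeCumulantOfMoments_eq {m r : ℕ → ℝ} (h0 : m 0 = 1)
    (h : ∀ n, 1 ≤ n → m n = ∑ s ∈ range (n + 1), if s = 0 then 0 else
      r s * PowerSeries.coeff (n - s) (PowerSeries.mk m ^ s))
    {n : ℕ} (hn : 1 ≤ n) : freeCumulantOfMoments m n = r n := by
  induction n using Nat.strong_induction_on with
  | _ n ih =>
    rw [freeCumulantOfMoments, if_neg (by omega), h n hn, sum_range_succ, if_neg (by omega)]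
    have hc : PowerSeries.coeff (n - n) (PowerSeries.mk m ^ n) = 1 := by
      simp [h0]
    rw [hc, mul_one, ← Fin.sum_univ_eq_sum_range
      (fun s => if s = 0 then 0 else r s * PowerSeries.coeff (n - s) (PowerSeries.mk m ^ s)),
      add_comm, add_sub_assoc, ← sum_sub_distrib, sum_eq_zero, add_zero]
    intro s _
    split_ifs with hs
    · rw [hs, freeCumulantOfMoments]; simp
    · rw [ih s s.2 (by omega), sub_self]

/-- All free cumulants of the free Poisson law are `1`. -/
theorem freeCumulant_freePoissonLaw {n : ℕ} (hn : 1 ≤ n) :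
    freeCumulant freePoissonLaw n = 1 := by
  simp only [freeCumulant, integral_pow_freePoissonLaw]
  refine freeCumulantOfMoments_eq (r := fun _ => 1) (by simp) (fun n hn => ?_) hn
  set M : PowerSeries ℝ := PowerSeries.mk fun l => (catalan l : ℝ) with hM
  have hM1 : M = 1 + PowerSeries.X * M ^ 2 := by
    have := congrArg (PowerSeries.map (Nat.castRingHom ℝ))
      PowerSeries.catalanSeries_sq_mul_X_add_one
    have h2 : PowerSeries.map (Nat.castRingHom ℝ) PowerSeries.catalanSeries = M := by
      ext; simp [hM]
    simp only [map_add, map_mul, map_pow, map_one, PowerSeries.map_X, h2] at this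
    rw [← this]; rw [this]; linear_combination -this
  -- `1 / (1 - z M) = M`, so `M = ∑ₛ (z M) ^ s`.
  have hgeom : M * (1 - (PowerSeries.X * M) ^ (n + 1)) =
      ∑ s ∈ range (n + 1), (PowerSeries.X * M) ^ s := by
    have h3 := mul_neg_geom_sum (PowerSeries.X * M) (n + 1)
    rw [← h3, ← mul_assoc]
    have : M * (1 - PowerSeries.X * M) = 1 := by linear_combination hM1
    rw [this, one_mul]
  have hcoeff := congrArg (PowerSeries.coeff n) hgeom
  rw [mul_sub, mul_one, map_sub, mul_pow, mul_left_comm, PowerSeries.coeff_X_pow_mul',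
    if_neg (by omega), sub_zero, map_sum, hM, PowerSeries.coeff_mk] at hcoeff
  rw [hcoeff]
  refine sum_congr rfl fun s hs => ?_
  rw [mem_range] at hs
  rw [mul_pow, PowerSeries.coeff_X_pow_mul', if_pos (by omega)]
  split_ifs with h
  · subst h
    simp [PowerSeries.coeff_one]
    omega
  · rw [one_mul]

/-- The only nonzero free cumulant of the semicircle law is the second one. -/
theorem freeCumulant_semicircleLaw {n : ℕ} (hn : 1 ≤ n) :
    freeCumulant semicircleLaw n = if n = 2 then 1 else 0 := by
  simp only [freeCumulant, integral_pow_semicircleLaw]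
  refine freeCumulantOfMoments_eq (r := fun n => if n = 2 then 1 else 0) (by simp)
    (fun n hn => ?_) hn
  set M : PowerSeries ℝ := PowerSeries.mk
    fun l => if 2 ∣ l then (catalan (l / 2) : ℝ) else 0 with hM
  have hM1 : M ^ 2 * PowerSeries.X ^ 2 + 1 = M := by
    -- `M(z) = C(z²)` for the Catalan series `C`
    have := congrArg (fun f => PowerSeries.expand 2 two_ne_zero
      (PowerSeries.map (Nat.castRingHom ℝ) f)) PowerSeries.catalanSeries_sq_mul_X_add_one
    have h2 : PowerSeries.expand 2 two_ne_zero
        (PowerSeries.map (Nat.castRingHom ℝ) PowerSeries.catalanSeries) = M := by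
      ext; simp [hM, PowerSeries.coeff_expand]
    simpa only [map_add, map_mul, map_pow, map_one, PowerSeries.map_X, h2,
      PowerSeries.expand_X] using this
  have hcoeff := congrArg (PowerSeries.coeff n) hM1
  rw [map_add, PowerSeries.coeff_mul_X_pow', PowerSeries.coeff_one, if_neg (show n ≠ 0 by omega),
    add_zero] at hcoeff
  rw [hM, PowerSeries.coeff_mk] at hcoeff
  rw [← hcoeff]
  split_ifs with h2
  · rw [sum_eq_single 2]
    · simp [hM]
    · intro s _ hs; simp [hs]
    · intro h; simp at h; omega
  · rw [sum_eq_zero]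
    intro s hs
    rw [mem_range] at hs
    have : s ≠ 2 := by omega
    simp [this]

/-! ### Lagrange inversion -/

/-- `Res (P' P^{-(n+1)})` vanishes for `n ≥ 1` and is `1` for `n = 0`, where `P = z u` and
`v = u⁻¹`; written without negative powers. -/
theorem coeff_derivative_mul_inv_pow {F : Type*} [Field F] [CharZero F] {u v : PowerSeries F}
    (huv : u * v = 1) (n : ℕ) :
    PowerSeries.coeff n (PowerSeries.derivative F (PowerSeries.X * u) * v ^ (n + 1)) =
      if n = 0 then 1 else 0 := by
  set D := PowerSeries.derivative F
  have hP : D (PowerSeries.X * u) = u + PowerSeries.X * D u := by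
    rw [Derivation.leibniz]
    simp only [D, PowerSeries.derivative_X, smul_eq_mul, mul_one]
    ring
  have hv : D u * v ^ 2 = - D v := by
    have h := congrArg D huv
    rw [Derivation.leibniz] at h
    simp only [smul_eq_mul, D, PowerSeries.derivative_one] at h
    linear_combination v * h + (-(D v)) * huv
  cases n with
  | zero =>
    have : PowerSeries.constantCoeff u * PowerSeries.constantCoeff v = 1 := by
      rw [← map_mul, huv, map_one]
    simp [hP, this]
  | succ n =>
    have hpow : D (v ^ (n + 1)) = ((n + 1 : ℕ) : PowerSeries F) * (v ^ n * D v) := by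
      rw [Derivation.leibniz_pow]
      simp
    have h1 : ((n + 1 : ℕ) : PowerSeries F) * (D (PowerSeries.X * u) * v ^ (n + 1 + 1)) =
        ((n + 1 : ℕ) : PowerSeries F) * v ^ (n + 1) - PowerSeries.X * D (v ^ (n + 1)) := by
      rw [hP, hpow]
      linear_combination ((n + 1 : ℕ) : PowerSeries F) * v ^ (n + 1) * huv +
        ((n + 1 : ℕ) : PowerSeries F) * PowerSeries.X * v ^ n * hv
    have h2 := congrArg (PowerSeries.coeff (n + 1)) h1
    rw [map_sub, PowerSeries.coeff_succ_X_mul, PowerSeries.coeff_derivative,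
      ← map_natCast (PowerSeries.C (R := F)), PowerSeries.coeff_C_mul,
      PowerSeries.coeff_C_mul] at h2
    have h3 : ((n + 1 : ℕ) : F) ≠ 0 := Nat.cast_ne_zero.2 n.succ_ne_zero
    rw [if_neg (by omega)]
    refine (mul_eq_zero.1 ?_).resolve_left h3
    rw [h2]
    push_cast
    ring

/-- **Lagrange inversion**, for a polynomial `φ`: if `P = z φ(P)` then
`k [z^k] P = [w^{k-1}] φ(w)^k`. -/
theorem lagrange_inversion {F : Type*} [Field F] [CharZero F] {P : PowerSeries F}
    {φ : Polynomial F} (hφ : φ.coeff 0 ≠ 0)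
    (hP : P = PowerSeries.X * Polynomial.aeval P φ) (k : ℕ) :
    ((k + 1 : ℕ) : F) * PowerSeries.coeff (k + 1) P = (φ ^ (k + 1)).coeff k := by
  set D := PowerSeries.derivative F
  set u : PowerSeries F := Polynomial.aeval P φ with hu
  have hP0 : PowerSeries.constantCoeff P = 0 := by rw [hP]; simp
  have hu0 : PowerSeries.constantCoeff u ≠ 0 := by
    have : PowerSeries.constantCoeff u = φ.coeff 0 := by
      rw [hu, Polynomial.aeval_eq_sum_range, map_sum, sum_eq_single 0]
      · simp
      · intro i _ hi
        simp [hP0, hi]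
      · simp
    rwa [this]
  set v : PowerSeries F := u⁻¹
  have huv : u * v = 1 := PowerSeries.mul_inv_cancel u hu0
  -- `φ^{k+1}(P) = u^{k+1}`; multiply by `P' v^{k+1}` and compare coefficients of `z^k`.
  have h1 : D P = ∑ i ∈ range ((φ ^ (k + 1)).natDegree + 1),
      PowerSeries.C ((φ ^ (k + 1)).coeff i) * (P ^ i * (D P * v ^ (k + 1))) := by
    have h2 : ∑ i ∈ range ((φ ^ (k + 1)).natDegree + 1),
        PowerSeries.C ((φ ^ (k + 1)).coeff i) * P ^ i = u ^ (k + 1) := by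
      rw [hu, ← map_pow, Polynomial.aeval_eq_sum_range]
      simp [PowerSeries.smul_eq_C_mul]
    simp only [← mul_assoc]
    rw [← sum_mul, ← sum_mul, h2, mul_assoc, mul_comm, mul_assoc, mul_comm (v ^ _), ← mul_pow,
      huv, one_pow, mul_one]
  have h3 := congrArg (PowerSeries.coeff k) h1
  rw [map_sum, PowerSeries.coeff_derivative] at h3
  have h4 : ∀ i, PowerSeries.coeff k (PowerSeries.C ((φ ^ (k + 1)).coeff i) *
      (P ^ i * (D P * v ^ (k + 1)))) = if i = k then (φ ^ (k + 1)).coeff k else 0 := by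
    intro i
    rw [PowerSeries.coeff_C_mul]
    have hPi : P ^ i * (D P * v ^ (k + 1)) = PowerSeries.X ^ i * (u ^ i * (D P * v ^ (k + 1))) := by
      conv_lhs => rw [show P ^ i = PowerSeries.X ^ i * u ^ i by rw [← mul_pow, ← hP]]
      ring
    rw [hPi, PowerSeries.coeff_X_pow_mul']
    by_cases hik : i ≤ k
    · obtain ⟨l, rfl⟩ := Nat.exists_eq_add_of_le hik
      have : u ^ i * (D P * v ^ (i + l + 1)) = D (PowerSeries.X * u) * v ^ (l + 1) := by
        rw [← hP]
        have : u ^ i * v ^ i = 1 := by rw [← mul_pow, huv, one_pow]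
        linear_combination (D P * v ^ (l + 1)) * this
      rw [if_pos hik, this, Nat.add_sub_cancel_left, coeff_derivative_mul_inv_pow huv]
      by_cases hl : l = 0
      · simp [hl]
      · simp [hl]
    · rw [if_neg hik, if_neg (by omega), mul_zero]
  rw [sum_congr rfl fun i _ => h4 i] at h3
  rw [sum_ite_eq'] at h3
  push_cast
  rw [mul_comm, h3]
  split_ifs with h
  · rfl
  · rw [Polynomial.coeff_eq_zero_of_natDegree_lt (by simpa using h)]

/-- The polynomial `(1 + w)^q ∏_c (d_c + w)` whose functional equation `P = z φ(P)` governs the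
generating function of the weighted counts. -/
noncomputable def kernelPoly (p q : ℕ) : Polynomial (MvPolynomial (Fin (p + 1)) ℝ) :=
  (1 + Polynomial.X) ^ q * ∏ c, (Polynomial.C (MvPolynomial.X c) + Polynomial.X)

theorem kernelPoly_coeff_zero_ne_zero (p q : ℕ) : (kernelPoly p q).coeff 0 ≠ 0 := by
  rw [Polynomial.coeff_zero_eq_eval_zero, kernelPoly]
  simp [Polynomial.eval_prod, prod_eq_zero_iff]

/-- Lagrange inversion over the polynomial ring, by passing to its fraction field. -/
theorem lagrange_inversion_kernelPoly {p q : ℕ} {P : PowerSeries (MvPolynomial (Fin (p + 1)) ℝ)}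
    (hP : P = PowerSeries.X * Polynomial.aeval P (kernelPoly p q)) (k : ℕ) :
    ((k + 1 : ℕ) : MvPolynomial (Fin (p + 1)) ℝ) * PowerSeries.coeff (k + 1) P =
      (kernelPoly p q ^ (k + 1)).coeff k := by
  let R := MvPolynomial (Fin (p + 1)) ℝ
  let f : R →+* FractionRing R := algebraMap R (FractionRing R)
  have hf : Function.Injective f := IsFractionRing.injective R (FractionRing R)
  have : CharZero (FractionRing R) := charZero_of_injective_ringHom hf
  have hP' : PowerSeries.map f P = PowerSeries.X *
      Polynomial.aeval (PowerSeries.map f P) ((kernelPoly p q).map f) := by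
    conv_lhs => rw [hP]
    rw [map_mul, PowerSeries.map_X]
    congr 1
    rw [Polynomial.aeval_def, Polynomial.aeval_def, Polynomial.eval₂_map, Polynomial.hom_eval₂]
    congr 1
    exact RingHom.ext fun x => by simp
  have hne : ((kernelPoly p q).map f).coeff 0 ≠ 0 := by
    rw [Polynomial.coeff_map]
    exact (map_ne_zero_iff f hf).2 (kernelPoly_coeff_zero_ne_zero p q)
  apply hf
  have := lagrange_inversion hne hP' k
  rw [PowerSeries.coeff_map, ← Polynomial.map_pow, Polynomial.coeff_map] at this
  rw [map_mul, map_natCast, this]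

/-- The choice of the exponents `m c` of the `d_c` in the factors `(d_c + w)^K` leaves a power
`K - m c` of `w` in each of them; the rest of `w^k` comes from `(1 + w)^(Kq)`. -/
theorem coeff_kernelPoly_pow {p q : ℕ} (K k : ℕ) (m : Fin (p + 1) →₀ ℕ) :
    MvPolynomial.coeff m ((kernelPoly p q ^ K).coeff k) =
      (∏ c, (K.choose (m c) : ℝ)) *
        (if ∑ c, (K - m c) ≤ k then ((K * q).choose (k - ∑ c, (K - m c)) : ℝ) else 0) := by
  have h1 : kernelPoly p q ^ K = ∑ x ∈ Fintype.piFinset fun _ : Fin (p + 1) => range (K + 1),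
      Polynomial.C (MvPolynomial.monomial (Finsupp.equivFunOnFinite.symm x)
        (∏ c, (K.choose (x c) : ℝ))) *
        ((1 + Polynomial.X) ^ (K * q) * Polynomial.X ^ ∑ c, (K - x c)) := by
    rw [kernelPoly, mul_pow, ← pow_mul, mul_comm q K, ← prod_pow]
    simp only [add_pow (Polynomial.C _)]
    rw [prod_univ_sum, mul_sum]
    refine sum_congr rfl fun x _ => ?_
    rw [prod_mul_distrib, prod_mul_distrib, prod_pow_eq_pow_sum, MvPolynomial.monomial_eq,
      Finsupp.prod_fintype _ _ (by simp)]
    simp only [Finsupp.equivFunOnFinite_symm_apply_apply, map_prod, map_mul, map_pow, map_natCast]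
    ring
  rw [h1, Polynomial.finsetSum_coeff, MvPolynomial.coeff_sum]
  simp only [Polynomial.coeff_C_mul, Polynomial.coeff_mul_X_pow', Polynomial.coeff_one_add_X_pow]
  have h2 : ∀ (x : Fin (p + 1) → ℕ) (n : ℕ) (Q : Prop) [Decidable Q] (a : ℝ),
      MvPolynomial.coeff m (MvPolynomial.monomial (Finsupp.equivFunOnFinite.symm x) a *
        (if Q then (n : MvPolynomial (Fin (p + 1)) ℝ) else 0)) =
      if x = ⇑m then a * (if Q then (n : ℝ) else 0) else 0 := by
    intro x n Q _ a
    have hx : Finsupp.equivFunOnFinite.symm x = m ↔ x = ⇑m := by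
      rw [Equiv.symm_apply_eq]; rfl
    split_ifs with h h' h'
    · rw [← map_natCast (MvPolynomial.C (R := ℝ) (σ := Fin (p + 1))), mul_comm,
        MvPolynomial.coeff_C_mul, MvPolynomial.coeff_monomial, if_pos (hx.2 h'), mul_comm]
    · rw [← map_natCast (MvPolynomial.C (R := ℝ) (σ := Fin (p + 1))), mul_comm,
        MvPolynomial.coeff_C_mul, MvPolynomial.coeff_monomial, if_neg (mt hx.1 h'), mul_zero]
    · simp
    · simp
  simp only [h2]
  rw [sum_ite_eq']
  by_cases h : ⇑m ∈ Fintype.piFinset fun _ : Fin (p + 1) => range (K + 1)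
  · rw [if_pos h]
  · rw [if_neg h]
    rw [Fintype.mem_piFinset] at h
    push Not at h
    obtain ⟨c, hc⟩ := h
    rw [prod_eq_zero (mem_univ c), zero_mul]
    rw [Nat.choose_eq_zero_of_lt (by simpa using hc), Nat.cast_zero]

/-- The coefficient of `z^k` in the solution of `P = z (1 + P)^q ∏_c (d_c + P)`, the exponents of
`d_0` being shifted by one. -/
theorem coeff_solution {p q k : ℕ} (hk : 1 ≤ k) {P : PowerSeries (MvPolynomial (Fin (p + 1)) ℝ)}
    (hP : P = PowerSeries.X * ((1 + P) ^ q * ∏ c, (PowerSeries.C (MvPolynomial.X c) + P)))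
    (j : Fin (p + 1) → ℕ) :
    MvPolynomial.coeff (Finsupp.equivFunOnFinite.symm j + Finsupp.single 0 1)
      (PowerSeries.coeff k P) =
      1 / (k : ℝ) * (k.choose (j 0 + 1) : ℝ) * (∏ i : Fin p, (k.choose (j i.succ) : ℝ)) *
        (binom (k * q) ((∑ i, (j i : ℤ)) - (k : ℤ) * (p : ℤ)) : ℝ) := by
  have hP' : P = PowerSeries.X * Polynomial.aeval P (kernelPoly p q) := by
    conv_lhs => rw [hP]
    simp [kernelPoly, map_prod]
  obtain ⟨l, rfl⟩ := Nat.exists_eq_add_of_le' hk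
  set m : Fin (p + 1) →₀ ℕ := Finsupp.equivFunOnFinite.symm j + Finsupp.single 0 1 with hm
  have hm0 : m 0 = j 0 + 1 := by simp [hm]
  have hms : ∀ i : Fin p, m i.succ = j i.succ := fun i => by
    simp [hm, Fin.succ_ne_zero]
  have h := congrArg (MvPolynomial.coeff m) (lagrange_inversion_kernelPoly hP' l)
  rw [coeff_kernelPoly_pow, ← map_natCast (MvPolynomial.C (R := ℝ) (σ := Fin (p + 1))),
    MvPolynomial.coeff_C_mul, Fin.prod_univ_succ, hm0] at h
  simp only [hms] at h
  have hl : ((l + 1 : ℕ) : ℝ) ≠ 0 := Nat.cast_ne_zero.2 l.succ_ne_zero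
  rw [mul_assoc, mul_assoc, one_div, eq_inv_mul_iff_mul_eq₀ hl, h, ← mul_assoc]
  by_cases hle : ∀ c, m c ≤ l + 1
  · congr 1
    have hsum : ((∑ c, (l + 1 - m c) : ℕ) : ℤ) =
        ((p : ℤ) + 1) * (l + 1) - (∑ i, (j i : ℤ)) - 1 := by
      have : ∀ c, ((l + 1 - m c : ℕ) : ℤ) = (l + 1) - (m c : ℤ) := fun c => by
        rw [Nat.cast_sub (hle c)]; push_cast; ring
      rw [Nat.cast_sum, sum_congr rfl fun c _ => this c, sum_sub_distrib,
        Fin.sum_univ_succ (fun c => (m c : ℤ)), Fin.sum_univ_succ (fun c => (j c : ℤ)), hm0]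
      simp only [hms]
      simp
      ring
    have hb : (∑ i, (j i : ℤ)) - ((l + 1 : ℕ) : ℤ) * (p : ℤ) =
        (l : ℤ) - ((∑ c, (l + 1 - m c) : ℕ) : ℤ) := by
      rw [hsum]; push_cast; ring
    rw [binom, hb]
    split_ifs with h1 h2 h2
    · congr 3
      omega
    · omega
    · omega
    · simp
  · push Not at hle
    obtain ⟨c, hc⟩ := hle
    have : ((l + 1).choose (j 0 + 1) : ℝ) * (∏ i : Fin p, ((l + 1).choose (j i.succ) : ℝ)) = 0 := by
      have h0 : ∏ c, ((l + 1).choose (m c) : ℝ) = 0 :=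
        prod_eq_zero (mem_univ c) (by rw [Nat.choose_eq_zero_of_lt hc, Nat.cast_zero])
      rw [Fin.prod_univ_succ, hm0] at h0
      simpa only [hms] using h0
    rw [this, zero_mul, zero_mul]

/-! ### Sums over noncrossing partitions of intervals -/

/-- `P` is a noncrossing partition of the finite set `S` of natural numbers, given as the set of
its blocks. -/
structure IsNCPartition (S : Finset ℕ) (P : Finset (Finset ℕ)) : Prop where
  nonempty : ∀ V ∈ P, V.Nonempty
  mem_iff : ∀ x, x ∈ S ↔ ∃ V ∈ P, x ∈ V
  eq_of_mem : ∀ V ∈ P, ∀ V' ∈ P, ∀ x, x ∈ V → x ∈ V' → V = V'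
  noncrossing : ∀ V ∈ P, ∀ V' ∈ P, ∀ x y z w, x < y → y < z → z < w →
    x ∈ V → z ∈ V → y ∈ V' → w ∈ V' → V = V'

open scoped Classical in
/-- The noncrossing partitions of `S`. -/
noncomputable def ncPartitions (S : Finset ℕ) : Finset (Finset (Finset ℕ)) :=
  {P ∈ S.powerset.powerset | IsNCPartition S P}

theorem mem_ncPartitions {S : Finset ℕ} {P : Finset (Finset ℕ)} :
    P ∈ ncPartitions S ↔ IsNCPartition S P := by
  classical
  rw [ncPartitions, mem_filter, and_iff_right_iff_imp]
  intro h
  rw [mem_powerset]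
  intro V hV
  rw [mem_powerset]
  exact fun x hx => (h.mem_iff x).2 ⟨V, hV, hx⟩

variable {R : Type*} [CommRing R]

/-- The sum over the noncrossing partitions of `[a, b)` of the product of the weights of the
blocks, where the block of `a` has weight `σ` and all others have weight `w`. -/
noncomputable def rootedSum (w σ : Finset ℕ → R) (a b : ℕ) : R :=
  ∑ P ∈ ncPartitions (Ico a b), ∏ V ∈ P, if a ∈ V then σ V else w V

/-- The sum over the noncrossing partitions of `[a, b)` of the product of the weights of the
blocks. -/
noncomputable def ncSum (w : Finset ℕ → R) (a b : ℕ) : R := rootedSum w w a b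

theorem ncSum_eq (w : Finset ℕ → R) (a b : ℕ) :
    ncSum w a b = ∑ P ∈ ncPartitions (Ico a b), ∏ V ∈ P, w V := by
  simp [ncSum, rootedSum]

theorem ncPartitions_empty : ncPartitions ∅ = {∅} := by
  ext P
  rw [mem_ncPartitions, mem_singleton]
  constructor
  · intro h
    refine eq_empty_of_forall_notMem fun V hV => ?_
    obtain ⟨x, hx⟩ := h.nonempty V hV
    exact absurd ((h.mem_iff x).2 ⟨V, hV, hx⟩) (by simp)
  · rintro rfl
    constructor <;> simp

theorem rootedSum_of_le (w σ : Finset ℕ → R) {a b : ℕ} (h : b ≤ a) : rootedSum w σ a b = 1 := by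
  rw [rootedSum, Ico_eq_empty (by omega), ncPartitions_empty]
  simp

/-- In `P`, the successor of `a` in its block is `t`. -/
def IsNext (a t : ℕ) (P : Finset (Finset ℕ)) : Prop :=
  ∃ V ∈ P, a ∈ V ∧ t ∈ V ∧ ∀ x ∈ V, x = a ∨ t ≤ x

/-- Add `a` to the block if it contains `t`. -/
def joinAt (a t : ℕ) (V : Finset ℕ) : Finset ℕ := if t ∈ V then insert a V else V

section Split

variable {a t b : ℕ}

theorem mem_joinAt {x : ℕ} {V : Finset ℕ} : x ∈ joinAt a t V ↔ x ∈ V ∨ (x = a ∧ t ∈ V) := by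
  unfold joinAt
  split_ifs with h <;> simp [h, or_comm]

theorem erase_joinAt {V : Finset ℕ} (h : a ∉ V) : (joinAt a t V).erase a = V := by
  ext x
  rw [mem_erase, mem_joinAt]
  constructor
  · tauto
  · intro hx
    exact ⟨fun h' => h (h' ▸ hx), Or.inl hx⟩

theorem mem_of_isNCPartition {S : Finset ℕ} {P : Finset (Finset ℕ)} (h : IsNCPartition S P)
    {V : Finset ℕ} (hV : V ∈ P) {x : ℕ} (hx : x ∈ V) : x ∈ S := (h.mem_iff x).2 ⟨V, hV, hx⟩

/-- Glueing a noncrossing partition of `(a, t)` and one of `[t, b)`, by adding `a` to the block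
of `t`. -/
theorem isNCPartition_glue {P₁ P₂ : Finset (Finset ℕ)} (hat : a < t) (htb : t < b)
    (h₁ : IsNCPartition (Ico (a + 1) t) P₁) (h₂ : IsNCPartition (Ico t b) P₂) :
    IsNCPartition (Ico a b) (P₁ ∪ P₂.image (joinAt a t)) := by
  have hm : ∀ W, W ∈ P₁ ∪ P₂.image (joinAt a t) ↔ W ∈ P₁ ∨ ∃ V ∈ P₂, joinAt a t V = W := by
    simp
  have b₁ : ∀ V ∈ P₁, ∀ x ∈ V, a < x ∧ x < t := fun V hV x hx => by
    have := mem_of_isNCPartition h₁ hV hx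
    rw [mem_Ico] at this
    omega
  have b₂ : ∀ V ∈ P₂, ∀ x ∈ V, t ≤ x ∧ x < b := fun V hV x hx => by
    have := mem_of_isNCPartition h₂ hV hx
    rwa [mem_Ico] at this
  refine ⟨fun W hW => ?_, fun x => ?_, fun W hW W' hW' x hx hx' => ?_,
    fun W hW W' hW' x y z w hxy hyz hzw hx hz hy hw => ?_⟩
  · rcases (hm W).1 hW with hW | ⟨V, hV, rfl⟩
    · exact h₁.nonempty W hW
    · obtain ⟨x, hx⟩ := h₂.nonempty V hV
      exact ⟨x, mem_joinAt.2 (Or.inl hx)⟩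
  · constructor
    · intro hx
      rw [mem_Ico] at hx
      rcases lt_or_ge x t with h | h
      · rcases eq_or_lt_of_le hx.1 with h' | h'
        · obtain ⟨V, hV, htV⟩ := (h₂.mem_iff t).1 (mem_Ico.2 ⟨le_rfl, htb⟩)
          exact ⟨_, (hm _).2 (Or.inr ⟨V, hV, rfl⟩), mem_joinAt.2 (Or.inr ⟨h'.symm, htV⟩)⟩
        · obtain ⟨V, hV, hxV⟩ := (h₁.mem_iff x).1 (mem_Ico.2 ⟨h', h⟩)
          exact ⟨V, (hm _).2 (Or.inl hV), hxV⟩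
      · obtain ⟨V, hV, hxV⟩ := (h₂.mem_iff x).1 (mem_Ico.2 ⟨h, hx.2⟩)
        exact ⟨_, (hm _).2 (Or.inr ⟨V, hV, rfl⟩), mem_joinAt.2 (Or.inl hxV)⟩
    · rintro ⟨W, hW, hx⟩
      rw [mem_Ico]
      rcases (hm W).1 hW with hW | ⟨V, hV, rfl⟩
      · have := b₁ W hW x hx
        omega
      · rcases mem_joinAt.1 hx with h | ⟨h, -⟩
        · have := b₂ V hV x h
          omega
        · omega
  · rcases (hm W).1 hW with hW | ⟨V, hV, rfl⟩ <;> rcases (hm W').1 hW' with hW' | ⟨V', hV', rfl⟩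
    · exact h₁.eq_of_mem W hW W' hW' x hx hx'
    · exfalso
      have := b₁ W hW x hx
      rcases mem_joinAt.1 hx' with h | ⟨h, -⟩
      · have := b₂ V' hV' x h
        omega
      · omega
    · exfalso
      have := b₁ W' hW' x hx'
      rcases mem_joinAt.1 hx with h | ⟨h, -⟩
      · have := b₂ V hV x h
        omega
      · omega
    · congr 1
      rcases mem_joinAt.1 hx with h | ⟨h, ht⟩ <;> rcases mem_joinAt.1 hx' with h' | ⟨h', ht'⟩
      · exact h₂.eq_of_mem V hV V' hV' x h h'
      · have := b₂ V hV x h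
        omega
      · have := b₂ V' hV' x h'
        omega
      · exact h₂.eq_of_mem V hV V' hV' t ht ht'
  · rcases (hm W).1 hW with hW | ⟨V, hV, rfl⟩ <;> rcases (hm W').1 hW' with hW' | ⟨V', hV', rfl⟩
    · exact h₁.noncrossing W hW W' hW' x y z w hxy hyz hzw hx hz hy hw
    · exfalso
      have := b₁ W hW x hx
      have := b₁ W hW z hz
      rcases mem_joinAt.1 hy with h | ⟨h, -⟩
      · have := b₂ V' hV' y h
        omega
      · omega
    · exfalso
      have := b₁ W' hW' y hy
      have := b₁ W' hW' w hw
      rcases mem_joinAt.1 hz with h | ⟨h, -⟩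
      · have := b₂ V hV z h
        omega
      · omega
    · congr 1
      have ha : ∀ U ∈ P₂, ∀ s ∈ joinAt a t U, a ≤ s := fun U hU s hs => by
        rcases mem_joinAt.1 hs with h | ⟨h, -⟩
        · have := b₂ U hU s h
          omega
        · omega
      have hxa := ha V hV x hx
      have hy' : y ∈ V' := (mem_joinAt.1 hy).resolve_right (by omega)
      have hz' : z ∈ V := (mem_joinAt.1 hz).resolve_right (by omega)
      have hw' : w ∈ V' := (mem_joinAt.1 hw).resolve_right (by omega)
      have hty := (b₂ V' hV' y hy').1
      rcases mem_joinAt.1 hx with h | ⟨h, ht⟩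
      · exact h₂.noncrossing V hV V' hV' x y z w hxy hyz hzw h hz' hy' hw'
      · rcases eq_or_lt_of_le hty with h' | h'
        · exact h₂.eq_of_mem V hV V' hV' t ht (h' ▸ hy')
        · exact h₂.noncrossing V hV V' hV' t y z w h' hyz hzw ht hz' hy' hw'

/-- If `t` is the successor of `a` in its block, then all blocks are inside or outside
`(a, t)`. -/
theorem inside_or_outside {P : Finset (Finset ℕ)} (h : IsNCPartition (Ico a b) P)
    (hn : IsNext a t P) {V : Finset ℕ} (hV : V ∈ P) :
    (∀ x ∈ V, a < x ∧ x < t) ∨ (∀ x ∈ V, x = a ∨ t ≤ x) := by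
  obtain ⟨V₀, hV₀, ha, ht, h₀⟩ := hn
  by_contra! hcon
  obtain ⟨⟨z, hz, hz'⟩, ⟨y, hy, hya, hyt⟩⟩ := hcon
  have hne : V₀ ≠ V := fun h' => by
    have := h₀ y (h' ▸ hy)
    omega
  have hay : a ≤ y := (mem_Ico.1 (mem_of_isNCPartition h hV hy)).1
  have haz : a ≤ z := (mem_Ico.1 (mem_of_isNCPartition h hV hz)).1
  have hza : z ≠ a := fun h' => hne (h.eq_of_mem V₀ hV₀ V hV a ha (h' ▸ hz))
  have hzt : z ≠ t := fun h' => hne (h.eq_of_mem V₀ hV₀ V hV t ht (h' ▸ hz))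
  have h1 := hz' (by omega)
  exact hne (h.noncrossing V₀ hV₀ V hV a y t z (by omega) (by omega) (by omega) ha ht hy hz)

/-- The part of `P` inside `(a, t)`. -/
def innerPart (a t : ℕ) (P : Finset (Finset ℕ)) : Finset (Finset ℕ) := {V ∈ P | V ⊆ Ioo a t}

/-- The part of `P` outside `(a, t)`, with `a` removed. -/
def outerPart (a t : ℕ) (P : Finset (Finset ℕ)) : Finset (Finset ℕ) :=
  {V ∈ P | ¬ V ⊆ Ioo a t}.image fun V => V.erase a

theorem mem_innerPart {P : Finset (Finset ℕ)} {V : Finset ℕ} :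
    V ∈ innerPart a t P ↔ V ∈ P ∧ ∀ x ∈ V, a < x ∧ x < t := by
  simp [innerPart, subset_iff]

theorem mem_outerPart {P : Finset (Finset ℕ)} (h : IsNCPartition (Ico a b) P)
    (hn : IsNext a t P) {W : Finset ℕ} :
    W ∈ outerPart a t P ↔ ∃ V ∈ P, (∀ x ∈ V, x = a ∨ t ≤ x) ∧ V.erase a = W := by
  simp only [outerPart, mem_image, mem_filter, and_assoc]
  refine exists_congr fun V => and_congr_right fun hV => and_congr_left fun _ => ?_
  constructor
  · intro hV'
    refine (inside_or_outside h hn hV).resolve_left fun h' => hV' fun x hx => ?_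
    exact mem_Ioo.2 (h' x hx)
  · intro h1 h2
    obtain ⟨x, hx⟩ := h.nonempty V hV
    have := mem_Ioo.1 (h2 hx)
    have := h1 x hx
    omega

theorem isNCPartition_innerPart {P : Finset (Finset ℕ)} (h : IsNCPartition (Ico a b) P)
    (htb : t < b) (hn : IsNext a t P) : IsNCPartition (Ico (a + 1) t) (innerPart a t P) := by
  refine ⟨fun V hV => h.nonempty V (mem_innerPart.1 hV).1, fun x => ?_,
    fun V hV V' hV' => h.eq_of_mem V (mem_innerPart.1 hV).1 V' (mem_innerPart.1 hV').1,
    fun V hV V' hV' => h.noncrossing V (mem_innerPart.1 hV).1 V' (mem_innerPart.1 hV').1⟩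
  constructor
  · intro hx
    rw [mem_Ico] at hx
    obtain ⟨V, hV, hxV⟩ := (h.mem_iff x).1 (mem_Ico.2 ⟨by omega, by omega⟩)
    refine ⟨V, mem_innerPart.2 ⟨hV, (inside_or_outside h hn hV).resolve_right fun h' => ?_⟩, hxV⟩
    have := h' x hxV
    omega
  · rintro ⟨V, hV, hxV⟩
    exact mem_Ico.2 ((mem_innerPart.1 hV).2 x hxV)

theorem isNCPartition_outerPart {P : Finset (Finset ℕ)} (h : IsNCPartition (Ico a b) P)
    (hat : a < t) (hn : IsNext a t P) : IsNCPartition (Ico t b) (outerPart a t P) := by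
  have hm := @mem_outerPart a t b P h hn
  have hn' := hn
  obtain ⟨V₀, hV₀, ha, ht, h₀⟩ := hn
  refine ⟨fun W hW => ?_, fun x => ?_, fun W hW W' hW' x hx hx' => ?_,
    fun W hW W' hW' x y z w hxy hyz hzw hx hz hy hw => ?_⟩
  · obtain ⟨V, hV, hVo, rfl⟩ := hm.1 hW
    obtain ⟨x, hx⟩ := h.nonempty V hV
    by_cases hxa : x = a
    · refine ⟨t, mem_erase.2 ⟨hat.ne', ?_⟩⟩
      rwa [h.eq_of_mem V hV V₀ hV₀ a (hxa ▸ hx) ha]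
    · exact ⟨x, mem_erase.2 ⟨hxa, hx⟩⟩
  · constructor
    · intro hx
      rw [mem_Ico] at hx
      obtain ⟨V, hV, hxV⟩ := (h.mem_iff x).1 (mem_Ico.2 ⟨by omega, by omega⟩)
      refine ⟨V.erase a, hm.2 ⟨V, hV, (inside_or_outside h hn' hV).resolve_left fun h' => ?_, rfl⟩,
        mem_erase.2 ⟨by omega, hxV⟩⟩
      have := h' x hxV
      omega
    · rintro ⟨W, hW, hx⟩
      obtain ⟨V, hV, hVo, rfl⟩ := hm.1 hW
      rw [mem_erase] at hx
      have := mem_Ico.1 (mem_of_isNCPartition h hV hx.2)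
      have := hVo x hx.2
      exact mem_Ico.2 ⟨by omega, by omega⟩
  · obtain ⟨V, hV, hVo, rfl⟩ := hm.1 hW
    obtain ⟨V', hV', hVo', rfl⟩ := hm.1 hW'
    rw [h.eq_of_mem V hV V' hV' x (mem_of_mem_erase hx) (mem_of_mem_erase hx')]
  · obtain ⟨V, hV, hVo, rfl⟩ := hm.1 hW
    obtain ⟨V', hV', hVo', rfl⟩ := hm.1 hW'
    rw [h.noncrossing V hV V' hV' x y z w hxy hyz hzw (mem_of_mem_erase hx) (mem_of_mem_erase hz)
      (mem_of_mem_erase hy) (mem_of_mem_erase hw)]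

open scoped Classical in
theorem sum_isNext (w σ : Finset ℕ → R) (hat : a < t) (htb : t < b) :
    ∑ P ∈ ncPartitions (Ico a b) with IsNext a t P, ∏ V ∈ P, (if a ∈ V then σ V else w V) =
      ncSum w (a + 1) t * rootedSum w (fun V => σ (insert a V)) t b := by
  rw [ncSum_eq, rootedSum, sum_mul_sum, ← sum_product']
  symm
  refine sum_nbij' (fun P => P.1 ∪ P.2.image (joinAt a t))
    (fun P => (innerPart a t P, outerPart a t P)) ?_ ?_ ?_ ?_ ?_
  · rintro ⟨P₁, P₂⟩ hP
    rw [mem_product, mem_ncPartitions, mem_ncPartitions] at hP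
    obtain ⟨h₁, h₂⟩ := hP
    rw [mem_filter, mem_ncPartitions]
    refine ⟨isNCPartition_glue hat htb h₁ h₂, ?_⟩
    obtain ⟨V, hV, htV⟩ := (h₂.mem_iff t).1 (mem_Ico.2 ⟨le_rfl, htb⟩)
    refine ⟨joinAt a t V, mem_union_right _ (mem_image_of_mem _ hV),
      mem_joinAt.2 (Or.inr ⟨rfl, htV⟩), mem_joinAt.2 (Or.inl htV), fun x hx => ?_⟩
    rcases mem_joinAt.1 hx with h | ⟨h, -⟩
    · exact Or.inr (mem_Ico.1 (mem_of_isNCPartition h₂ hV h)).1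
    · exact Or.inl h
  · intro P hP
    rw [mem_filter, mem_ncPartitions] at hP
    rw [mem_product, mem_ncPartitions, mem_ncPartitions]
    exact ⟨isNCPartition_innerPart hP.1 htb hP.2, isNCPartition_outerPart hP.1 hat hP.2⟩
  · rintro ⟨P₁, P₂⟩ hP
    rw [mem_product, mem_ncPartitions, mem_ncPartitions] at hP
    obtain ⟨h₁, h₂⟩ := hP
    have b₁ : ∀ V ∈ P₁, V ⊆ Ioo a t := fun V hV x hx => by
      have := mem_Ico.1 (mem_of_isNCPartition h₁ hV hx)
      exact mem_Ioo.2 ⟨by omega, by omega⟩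
    have b₂ : ∀ V ∈ P₂, ∀ x ∈ V, t ≤ x := fun V hV x hx =>
      (mem_Ico.1 (mem_of_isNCPartition h₂ hV hx)).1
    have b₃ : ∀ V ∈ P₂, ¬ joinAt a t V ⊆ Ioo a t := fun V hV h => by
      obtain ⟨x, hx⟩ := h₂.nonempty V hV
      have := mem_Ioo.1 (h (mem_joinAt.2 (Or.inl hx)))
      have := b₂ V hV x hx
      omega
    refine Prod.ext ?_ ?_
    · ext V
      simp only [innerPart, mem_filter, mem_union, mem_image]
      constructor
      · rintro ⟨hV | ⟨V', hV', rfl⟩, h⟩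
        · exact hV
        · exact absurd h (b₃ V' hV')
      · exact fun hV => ⟨Or.inl hV, b₁ V hV⟩
    · ext V
      simp only [outerPart, mem_image, mem_filter, mem_union]
      have b₄ : ∀ V ∈ P₂, a ∉ V := fun V hV ha => by
        have := b₂ V hV a ha
        omega
      constructor
      · rintro ⟨W, ⟨hW | ⟨V', hV', rfl⟩, h⟩, rfl⟩
        · exact absurd (b₁ W hW) h
        · rwa [erase_joinAt (b₄ V' hV')]
      · exact fun hV => ⟨joinAt a t V, ⟨Or.inr ⟨V, hV, rfl⟩, b₃ V hV⟩, erase_joinAt (b₄ V hV)⟩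
  · intro P hP
    rw [mem_filter, mem_ncPartitions] at hP
    obtain ⟨h, hn⟩ := hP
    have hm := @mem_outerPart a t b P h hn
    have hj : ∀ V ∈ P, (∀ x ∈ V, x = a ∨ t ≤ x) → joinAt a t (V.erase a) = V := by
      intro V hV hVo
      obtain ⟨V₀, hV₀, ha, ht, h₀⟩ := hn
      ext x
      rw [mem_joinAt, mem_erase, mem_erase]
      constructor
      · rintro (hx | ⟨rfl, -, hx⟩)
        · exact hx.2
        · rwa [h.eq_of_mem V hV V₀ hV₀ t hx ht]
      · intro hx
        by_cases hxa : x = a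
        · refine Or.inr ⟨hxa, hat.ne', ?_⟩
          rwa [h.eq_of_mem V hV V₀ hV₀ a (hxa ▸ hx) ha]
        · exact Or.inl ⟨hxa, hx⟩
    ext V
    simp only [mem_union, mem_image, mem_innerPart]
    constructor
    · rintro (hV | ⟨W, hW, rfl⟩)
      · exact hV.1
      · obtain ⟨V, hV, hVo, rfl⟩ := hm.1 hW
        rwa [hj V hV hVo]
    · intro hV
      rcases inside_or_outside h hn hV with h' | h'
      · exact Or.inl ⟨hV, h'⟩
      · exact Or.inr ⟨V.erase a, hm.2 ⟨V, hV, h', rfl⟩, hj V hV h'⟩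
  · rintro ⟨P₁, P₂⟩ hP
    rw [mem_product, mem_ncPartitions, mem_ncPartitions] at hP
    obtain ⟨h₁, h₂⟩ := hP
    have b₁ : ∀ V ∈ P₁, ∀ x ∈ V, a < x ∧ x < t := fun V hV x hx => by
      have := mem_Ico.1 (mem_of_isNCPartition h₁ hV hx)
      omega
    have b₂ : ∀ V ∈ P₂, ∀ x ∈ V, t ≤ x := fun V hV x hx =>
      (mem_Ico.1 (mem_of_isNCPartition h₂ hV hx)).1
    have b₄ : ∀ V ∈ P₂, a ∉ V := fun V hV ha => by
      have := b₂ V hV a ha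
      omega
    have hdisj : Disjoint P₁ (P₂.image (joinAt a t)) := by
      rw [disjoint_left]
      intro V hV hV'
      obtain ⟨W, hW, rfl⟩ := mem_image.1 hV'
      obtain ⟨x, hx⟩ := h₂.nonempty W hW
      have := b₁ _ hV x (mem_joinAt.2 (Or.inl hx))
      have := b₂ W hW x hx
      omega
    have hinj : Set.InjOn (joinAt a t) P₂ := fun V hV V' hV' h => by
      rw [← erase_joinAt (t := t) (b₄ V hV), h, erase_joinAt (b₄ V' hV')]
    dsimp only
    rw [prod_union hdisj, prod_image hinj]
    congr 1
    · refine prod_congr rfl fun V hV => ?_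
      rw [if_neg]
      intro ha
      have := b₁ V hV a ha
      omega
    · refine prod_congr rfl fun V hV => ?_
      unfold joinAt
      split_ifs with h h' h'
      · rfl
      · simp at h'
      · exact absurd h' (b₄ V hV)
      · rfl

open scoped Classical in
theorem sum_singleton_mem (w σ : Finset ℕ → R) (hab : a < b) :
    ∑ P ∈ ncPartitions (Ico a b) with {a} ∈ P, ∏ V ∈ P, (if a ∈ V then σ V else w V) =
      σ {a} * ncSum w (a + 1) b := by
  rw [ncSum_eq, mul_sum]
  symm
  have hnot : ∀ P, IsNCPartition (Ico (a + 1) b) P → ∀ V ∈ P, a ∉ V := fun P hP V hV ha => by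
    have := mem_Ico.1 (mem_of_isNCPartition hP hV ha)
    omega
  have hnot' : ∀ P, IsNCPartition (Ico (a + 1) b) P → {a} ∉ P := fun P hP ha =>
    hnot P hP _ ha (mem_singleton_self a)
  refine sum_nbij' (fun P => insert {a} P) (fun P => P.erase {a}) ?_ ?_ ?_ ?_ ?_
  · intro P hP
    rw [mem_ncPartitions] at hP
    rw [mem_filter, mem_ncPartitions]
    refine ⟨⟨?_, fun x => ?_, ?_, ?_⟩, mem_insert_self _ _⟩
    · intro V hV
      rcases mem_insert.1 hV with rfl | hV
      · exact singleton_nonempty a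
      · exact hP.nonempty V hV
    · rw [exists_mem_insert, mem_singleton, ← hP.mem_iff, mem_Ico, mem_Ico]
      omega
    · intro V hV V' hV' x hx hx'
      rcases mem_insert.1 hV with rfl | hV <;> rcases mem_insert.1 hV' with rfl | hV'
      · rfl
      · rw [mem_singleton.1 hx] at hx'
        exact absurd hx' (hnot P hP V' hV')
      · rw [mem_singleton.1 hx'] at hx
        exact absurd hx (hnot P hP V hV)
      · exact hP.eq_of_mem V hV V' hV' x hx hx'
    · intro V hV V' hV' x y z w hxy hyz hzw hx hz hy hw
      rcases mem_insert.1 hV with rfl | hV <;> rcases mem_insert.1 hV' with rfl | hV'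
      · rfl
      · rw [mem_singleton] at hx hz
        omega
      · rw [mem_singleton] at hy hw
        omega
      · exact hP.noncrossing V hV V' hV' x y z w hxy hyz hzw hx hz hy hw
  · intro P hP
    rw [mem_filter, mem_ncPartitions] at hP
    obtain ⟨hP, ha⟩ := hP
    rw [mem_ncPartitions]
    refine ⟨fun V hV => hP.nonempty V (mem_of_mem_erase hV), fun x => ?_,
      fun V hV V' hV' => hP.eq_of_mem V (mem_of_mem_erase hV) V' (mem_of_mem_erase hV'),
      fun V hV V' hV' => hP.noncrossing V (mem_of_mem_erase hV) V' (mem_of_mem_erase hV')⟩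
    constructor
    · intro hx
      rw [mem_Ico] at hx
      obtain ⟨V, hV, hxV⟩ := (hP.mem_iff x).1 (mem_Ico.2 ⟨by omega, by omega⟩)
      refine ⟨V, mem_erase.2 ⟨?_, hV⟩, hxV⟩
      rintro rfl
      rw [mem_singleton] at hxV
      omega
    · rintro ⟨V, hV, hxV⟩
      rw [mem_erase] at hV
      have h1 := mem_Ico.1 (mem_of_isNCPartition hP hV.2 hxV)
      have h2 : x ≠ a := by
        rintro rfl
        exact hV.1 (hP.eq_of_mem V hV.2 _ ha x hxV (mem_singleton_self x))
      exact mem_Ico.2 ⟨by omega, h1.2⟩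
  · intro P hP
    rw [mem_ncPartitions] at hP
    exact erase_insert (hnot' P hP)
  · intro P hP
    exact insert_erase (mem_filter.1 hP).2
  · intro P hP
    rw [mem_ncPartitions] at hP
    rw [prod_insert (hnot' P hP), if_pos (mem_singleton_self a)]
    congr 1
    exact prod_congr rfl fun V hV => (if_neg (hnot P hP V hV)).symm

/-- Decomposition of the noncrossing partitions of `[a, b)` according to the successor of `a` in
its block. -/
theorem rootedSum_of_lt (w σ : Finset ℕ → R) (hab : a < b) :
    rootedSum w σ a b = σ {a} * ncSum w (a + 1) b +
      ∑ t ∈ Ioo a b, ncSum w (a + 1) t * rootedSum w (fun V => σ (insert a V)) t b := by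
  classical
  rw [← sum_singleton_mem w σ hab, ← sum_congr rfl fun t ht =>
    sum_isNext w σ (mem_Ioo.1 ht).1 (mem_Ioo.1 ht).2, rootedSum]
  simp only [sum_filter]
  rw [sum_comm, ← sum_add_distrib]
  refine sum_congr rfl fun P hP => ?_
  rw [mem_ncPartitions] at hP
  obtain ⟨V₀, hV₀, ha⟩ := (hP.mem_iff a).1 (mem_Ico.2 ⟨le_rfl, hab⟩)
  have huniq : ∀ V ∈ P, a ∈ V → V = V₀ := fun V hV haV => hP.eq_of_mem V hV V₀ hV₀ a haV ha
  by_cases h : {a} ∈ P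
  · rw [if_pos h, sum_eq_zero, add_zero]
    intro t ht
    rw [if_neg]
    rintro ⟨V, hV, haV, htV, -⟩
    rw [huniq V hV haV, ← huniq _ h (mem_singleton_self a), mem_singleton] at htV
    exact (mem_Ioo.1 ht).1.ne' htV
  · have hne : (V₀.erase a).Nonempty := by
      rw [nonempty_iff_ne_empty]
      intro he
      rw [erase_eq_empty_iff] at he
      rcases he with he | he
      · simp [he] at ha
      · exact h (he ▸ hV₀)
    set t₀ := (V₀.erase a).min' hne with ht₀
    have ht₀m : t₀ ∈ V₀.erase a := min'_mem _ _
    have ht₀b := mem_Ico.1 (mem_of_isNCPartition hP hV₀ (mem_of_mem_erase ht₀m))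
    have ht₀a := ne_of_mem_erase ht₀m
    have hmin : ∀ x ∈ V₀, x = a ∨ t₀ ≤ x := fun x hx => by
      by_cases hxa : x = a
      · exact Or.inl hxa
      · exact Or.inr (min'_le _ _ (mem_erase.2 ⟨hxa, hx⟩))
    rw [if_neg h, zero_add, sum_eq_single t₀]
    · rw [if_pos]
      exact ⟨V₀, hV₀, ha, mem_of_mem_erase ht₀m, hmin⟩
    · intro t ht htt
      rw [if_neg]
      rintro ⟨V, hV, haV, htV, hmin'⟩
      rw [huniq V hV haV] at htV hmin'
      have h1 := hmin t htV
      have h2 := hmin' t₀ (mem_of_mem_erase ht₀m)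
      have h3 := (mem_Ioo.1 ht).1
      omega
    · intro h'
      exact absurd (mem_Ioo.2 ⟨by omega, ht₀b.2⟩) h'

end Split

/-- Only the values of the weights on nonempty blocks in `[a, b)` matter, those of the root weight
only on blocks with minimum `a`. -/
theorem rootedSum_congr {w w' σ σ' : Finset ℕ → R} {a b : ℕ}
    (hw : ∀ V, a ∉ V → (∀ x ∈ V, a ≤ x) → V.Nonempty → w V = w' V)
    (hσ : ∀ V, a ∈ V → (∀ x ∈ V, a ≤ x) → σ V = σ' V) :
    rootedSum w σ a b = rootedSum w' σ' a b := by
  refine sum_congr rfl fun P hP => prod_congr rfl fun V hV => ?_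
  rw [mem_ncPartitions] at hP
  have h : ∀ x ∈ V, a ≤ x := fun x hx => (mem_Ico.1 (mem_of_isNCPartition hP hV hx)).1
  split_ifs with ha
  · exact hσ V ha h
  · exact hw V ha h (hP.nonempty V hV)

/-! ### The periodic word and its block weights -/

section Word

variable {p : ℕ}

/-- The color just before leg `x` of the infinite periodic word `W W W ⋯`, numbered from `0`. -/
def colorAt (p x : ℕ) : ℕ := min (x % (2 * p)) (2 * p - x % (2 * p))

/-- The label of leg `x` of the infinite periodic word, numbered from `0`. -/
def labelAt (p x : ℕ) : ℕ := min (x % (2 * p)) (2 * p - 1 - x % (2 * p))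

theorem colorAt_succ (hp : 1 ≤ p) (x : ℕ) :
    colorAt p (x + 1) = min (x % (2 * p) + 1) (2 * p - 1 - x % (2 * p)) := by
  have h := Nat.mod_lt x (show 2 * p > 0 by omega)
  have h1 : (x + 1) % (2 * p) = if x % (2 * p) + 1 = 2 * p then 0 else x % (2 * p) + 1 := by
    split_ifs with h2
    · rw [← Nat.mod_add_mod, h2, Nat.mod_self]
    · rw [← Nat.mod_add_mod, Nat.mod_eq_of_lt (by omega)]
  unfold colorAt
  rw [h1]
  split_ifs <;> omega

theorem dvd_add_succ_iff (hp : 1 ≤ p) (t a : ℕ) :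
    2 * p ∣ t + a + 1 ↔ t % (2 * p) + a % (2 * p) + 1 = 2 * p := by
  have h1 := Nat.mod_lt t (show 2 * p > 0 by omega)
  have h2 := Nat.mod_lt a (show 2 * p > 0 by omega)
  have h3 : (t + a + 1) % (2 * p) = (t % (2 * p) + a % (2 * p) + 1) % (2 * p) := by
    simp [Nat.add_mod]
  rw [Nat.dvd_iff_mod_eq_zero, h3]
  constructor
  · intro h
    obtain ⟨c, hc⟩ := Nat.dvd_of_mod_eq_zero h
    have : c = 1 := by
      rcases c with _ | _ | c
      · omega
      · rfl
      · have : 2 * p * (c + 1 + 1) = 2 * p * c + 2 * (2 * p) := by ring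
        omega
    rw [hc, this, mul_one]
  · intro h
    rw [h, Nat.mod_self]

/-- A leg `t` with the label of `a`, preceded by the color which follows `a`, is a mirror image
of `a`. -/
theorem dvd_of_labelAt_eq (hp : 1 ≤ p) {t a : ℕ} (hl : labelAt p t = labelAt p a)
    (hc : colorAt p t = colorAt p (a + 1)) : 2 * p ∣ t + a + 1 := by
  rw [dvd_add_succ_iff hp]
  rw [colorAt_succ hp] at hc
  have h1 := Nat.mod_lt t (show 2 * p > 0 by omega)
  have h2 := Nat.mod_lt a (show 2 * p > 0 by omega)
  unfold labelAt at hl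
  unfold colorAt at hc
  omega

theorem labelAt_of_dvd (hp : 1 ≤ p) {t a : ℕ} (h : 2 * p ∣ t + a + 1) :
    labelAt p t = labelAt p a := by
  rw [dvd_add_succ_iff hp] at h
  unfold labelAt
  omega

theorem colorAt_of_dvd (hp : 1 ≤ p) {t a : ℕ} (h : 2 * p ∣ t + a + 1) :
    colorAt p (t + 1) = colorAt p a := by
  rw [dvd_add_succ_iff hp] at h
  rw [colorAt_succ hp]
  unfold colorAt
  omega

theorem mod_eq_of_labelAt_eq (hp : 1 ≤ p) {s a : ℕ} (hl : labelAt p s = labelAt p a)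
    (hc : colorAt p s = colorAt p a) : s % (2 * p) = a % (2 * p) := by
  have h1 := Nat.mod_lt s (show 2 * p > 0 by omega)
  have h2 := Nat.mod_lt a (show 2 * p > 0 by omega)
  unfold labelAt at hl
  unfold colorAt at hc
  omega

theorem colorAt_succ_ne (hp : 1 ≤ p) (a : ℕ) : colorAt p (a + 1) ≠ colorAt p a := by
  rw [colorAt_succ hp]
  have h2 := Nat.mod_lt a (show 2 * p > 0 by omega)
  unfold colorAt
  omega

end Word

section Weights

variable {R : Type*} [CommRing R] (p : ℕ) (K : Finset ℕ) (d : ℕ → R)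

/-- The weight of a block `V` which continues a block with `n` legs of label `i`, with the
condition that the color after the last leg be `c`. The free cumulant `r_{n + |V|}` is `1` for
the free Poisson labels `i ∈ K`, and is `1` or `0` according as `n + |V| = 2` or not for the
semicircle labels. -/
def tailWeight (n c i : ℕ) (V : Finset ℕ) : R :=
  if (∀ s ∈ V, labelAt p s = i) ∧ ∀ s ∈ V, (∀ t ∈ V, t ≤ s) → colorAt p (s + 1) = c then
    (if i ∈ K ∨ n + V.card = 2 then 1 else 0) *
      ∏ s ∈ V, if ∃ t ∈ V, s < t then d (colorAt p (s + 1)) else 1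
  else 0

/-- The weight of a block `V`: it is `0` unless `V` is adapted to the word, in which case it is
the free cumulant times the monomial `d(V)`. -/
def blockWeight (V : Finset ℕ) : R :=
  if h : V.Nonempty then
    tailWeight p K d 0 (colorAt p (V.min' h)) (labelAt p (V.min' h)) V
  else 0

variable {p K d}

theorem blockWeight_eq {V : Finset ℕ} {a : ℕ} (ha : a ∈ V) (h : ∀ x ∈ V, a ≤ x) :
    blockWeight p K d V = tailWeight p K d 0 (colorAt p a) (labelAt p a) V := by
  have hne : V.Nonempty := ⟨a, ha⟩
  have : V.min' hne = a := le_antisymm (min'_le _ _ ha) (h _ (min'_mem _ _))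
  rw [blockWeight, dif_pos hne, this]

theorem tailWeight_singleton (n c i a : ℕ) : tailWeight p K d n c i {a} =
    if labelAt p a = i ∧ colorAt p (a + 1) = c then
      (if i ∈ K ∨ n + 1 = 2 then 1 else 0) else 0 := by
  simp [tailWeight]

theorem tailWeight_insert (n c i : ℕ) {a : ℕ} {V : Finset ℕ} (hV : V.Nonempty)
    (h : ∀ x ∈ V, a < x) : tailWeight p K d n c i (insert a V) =
      (if labelAt p a = i then d (colorAt p (a + 1)) else 0) *
        tailWeight p K d (n + 1) c i V := by
  have ha : a ∉ V := fun h' => lt_irrefl _ (h a h')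
  obtain ⟨y, hy⟩ := hV
  have h1 : (∀ s ∈ insert a V, (∀ t ∈ insert a V, t ≤ s) → colorAt p (s + 1) = c) ↔
      ∀ s ∈ V, (∀ t ∈ V, t ≤ s) → colorAt p (s + 1) = c := by
    constructor
    · intro H s hs hm
      refine H s (mem_insert_of_mem hs) fun t ht => ?_
      rcases mem_insert.1 ht with rfl | ht
      · exact (h s hs).le
      · exact hm t ht
    · intro H s hs hm
      rcases mem_insert.1 hs with rfl | hs
      · exact absurd (hm y (mem_insert_of_mem hy)) (not_le.2 (h y hy))
      · exact H s hs fun t ht => hm t (mem_insert_of_mem ht)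
  have h2 : (∏ s ∈ insert a V, if ∃ t ∈ insert a V, s < t then d (colorAt p (s + 1)) else 1) =
      d (colorAt p (a + 1)) * ∏ s ∈ V, if ∃ t ∈ V, s < t then d (colorAt p (s + 1)) else 1 := by
    rw [prod_insert ha, if_pos ⟨y, mem_insert_of_mem hy, h y hy⟩]
    congr 1
    refine prod_congr rfl fun s hs => ?_
    have : (∃ t ∈ insert a V, s < t) ↔ ∃ t ∈ V, s < t := by
      simp [(h s hs).le]
    simp only [this]
  unfold tailWeight
  simp only [h1, h2]
  simp only [forall_mem_insert, card_insert_of_notMem ha,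
    show n + 1 + V.card = n + (V.card + 1) by ring]
  by_cases hl : labelAt p a = i
  · simp only [hl, true_and, if_true]
    split_ifs <;> ring
  · simp [hl]

theorem rootedSum_const_mul (w σ : Finset ℕ → R) (c : R) {a b : ℕ} (hab : a < b) :
    rootedSum w (fun V => c * σ V) a b = c * rootedSum w σ a b := by
  rw [rootedSum, rootedSum, mul_sum]
  refine sum_congr rfl fun P hP => ?_
  rw [mem_ncPartitions] at hP
  obtain ⟨V₀, hV₀, ha⟩ := (hP.mem_iff a).1 (mem_Ico.2 ⟨le_rfl, hab⟩)
  have h1 : ∏ V ∈ P, (if a ∈ V then c else 1) = c := by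
    rw [prod_eq_single V₀]
    · rw [if_pos ha]
    · intro V hV hne
      rw [if_neg]
      exact fun haV => hne (hP.eq_of_mem V hV V₀ hV₀ a haV ha)
    · exact fun h => absurd hV₀ h
  conv_rhs => rw [← h1]
  rw [← prod_mul_distrib]
  refine prod_congr rfl fun V _ => ?_
  split_ifs <;> simp

variable (p K d)

/-- The total weight `Z(a, b)` of the noncrossing partitions of the legs `a, …, b - 1`. -/
noncomputable def wordSum (a b : ℕ) : R := ncSum (blockWeight p K d) a b

/-- The total weight of the noncrossing partitions of the legs `a, …, b - 1` whose block of `a`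
continues a block with `n` legs of label `i`, and has a last leg followed by the color `c`. -/
noncomputable def wordTailSum (n c i a b : ℕ) : R :=
  rootedSum (blockWeight p K d) (tailWeight p K d n c i) a b

variable {p K d}

theorem wordSum_of_le {a b : ℕ} (h : b ≤ a) : wordSum p K d a b = 1 := rootedSum_of_le _ _ h

theorem wordSum_eq_wordTailSum (a b : ℕ) :
    wordSum p K d a b = wordTailSum p K d 0 (colorAt p a) (labelAt p a) a b := by
  unfold wordSum wordTailSum ncSum
  exact rootedSum_congr (fun _ _ _ _ => rfl) fun _ ha h => blockWeight_eq ha h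

/-- Decomposition at the leg `t` which follows `a` in its block. -/
theorem wordTailSum_eq (n c i : ℕ) {a b : ℕ} (hab : a < b) :
    wordTailSum p K d n c i a b =
      (if labelAt p a = i ∧ colorAt p (a + 1) = c then
        (if i ∈ K ∨ n + 1 = 2 then 1 else 0) else 0) * wordSum p K d (a + 1) b +
      ∑ t ∈ Ioo a b, wordSum p K d (a + 1) t *
        ((if labelAt p a = i then d (colorAt p (a + 1)) else 0) *
          wordTailSum p K d (n + 1) c i t b) := by
  rw [wordTailSum, rootedSum_of_lt _ _ hab, tailWeight_singleton]
  refine congrArg₂ (fun x y : R => x + y) rfl (sum_congr rfl fun t ht => ?_)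
  rw [mem_Ioo] at ht
  unfold wordTailSum
  rw [← rootedSum_const_mul _ (tailWeight p K d (n + 1) c i) _ ht.2]
  refine congrArg₂ (fun x y : R => x * y) rfl ?_
  refine rootedSum_congr (fun _ _ _ _ => rfl) fun V htV h => ?_
  exact tailWeight_insert n c i ⟨t, htV⟩ fun x hx => ht.1.trans_le (h x hx)

theorem wordTailSum_of_labelAt_ne (n c : ℕ) {i a b : ℕ} (hab : a < b) (h : labelAt p a ≠ i) :
    wordTailSum p K d n c i a b = 0 := by
  rw [wordTailSum_eq n c i hab]
  simp [h]

/-- Joint induction for the total weights and the total weights with an open block. -/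
theorem colorAt_eq_aux (m : ℕ) : ∀ a b : ℕ, a ≤ b → b - a = m →
    (wordSum p K d a b ≠ 0 → colorAt p a = colorAt p b) ∧
    (a < b → ∀ n c i, wordTailSum p K d n c i a b ≠ 0 → c = colorAt p b) := by
  induction m using Nat.strong_induction_on with
  | _ m ih =>
    intro a b hab hm
    have h2 : a < b → ∀ n c i, wordTailSum p K d n c i a b ≠ 0 → c = colorAt p b := by
      intro hlt n c i hne
      by_contra hc
      apply hne
      rw [wordTailSum_eq n c i hlt, sum_eq_zero, add_zero]
      · split_ifs with h
        · by_cases h0 : wordSum p K d (a + 1) b = 0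
          · rw [h0, mul_zero]
          · exact absurd (h.2.symm.trans
              ((ih (b - (a + 1)) (by omega) (a + 1) b hlt rfl).1 h0)) hc
        · rw [zero_mul]
        · rw [zero_mul]
      · intro t ht
        rw [mem_Ioo] at ht
        by_cases h0 : wordTailSum p K d (n + 1) c i t b = 0
        · rw [h0, mul_zero, mul_zero]
        · exact absurd ((ih (b - t) (by omega) t b ht.2.le rfl).2 ht.2 _ _ _ h0) hc
    refine ⟨fun h => ?_, h2⟩
    rcases eq_or_lt_of_le hab with rfl | hlt
    · rfl
    · rw [wordSum_eq_wordTailSum] at h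
      exact h2 hlt _ _ _ h

/-- A stretch of legs which has an adapted partition starts and ends at the same color. -/
theorem colorAt_eq_of_wordSum_ne_zero {a b : ℕ} (hab : a ≤ b) (h : wordSum p K d a b ≠ 0) :
    colorAt p a = colorAt p b := (colorAt_eq_aux _ a b hab rfl).1 h

theorem wordTailSum_of_mem (n c : ℕ) {i : ℕ} (hi : i ∈ K) (a b : ℕ) :
    wordTailSum p K d n c i a b = wordTailSum p K d 0 c i a b :=
  rootedSum_congr (fun _ _ _ _ => rfl) fun V _ _ => by simp [tailWeight, hi]

theorem wordTailSum_two_of_notMem (c : ℕ) {i : ℕ} (hi : i ∉ K) {a b : ℕ} (hab : a < b) :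
    wordTailSum p K d 2 c i a b = 0 := by
  rw [wordTailSum, rootedSum_congr (σ' := fun V => 0 * tailWeight p K d 2 c i V)
    (fun _ _ _ _ => rfl) fun V ha _ => ?_, rootedSum_const_mul _ _ _ hab, zero_mul]
  have : V.card ≠ 0 := (card_pos.2 ⟨a, ha⟩).ne'
  simp [tailWeight, hi, this]

/-- Recursion for the total weights, according to the second leg `t` and, if it exists, the third
leg `s` of the block of `a`. As the stretches between consecutive legs have to start and
end at the same color, the letters of a block alternate between `i` and `i*`, which forces
`t ≡ -1 - a` and `s ≡ a` modulo `2p`. For the free Poisson labels the block can be continued at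
`s` as if it started there. -/
theorem wordSum_of_lt (hp : 1 ≤ p) {a b : ℕ} (hab : a < b) :
    wordSum p K d a b = d (colorAt p (a + 1)) * ∑ t ∈ Ioo a b, if 2 * p ∣ t + a + 1 then
      wordSum p K d (a + 1) t * (wordSum p K d (t + 1) b +
        (if labelAt p a ∈ K then 1 else 0) * d (colorAt p a) *
          ∑ s ∈ Ioo t b, if s % (2 * p) = a % (2 * p) then
            wordSum p K d (t + 1) s * wordSum p K d s b else 0) else 0 := by
  rw [wordSum_eq_wordTailSum a b, wordTailSum_eq _ _ _ hab,
    if_neg fun h => colorAt_succ_ne hp a h.2, zero_mul, zero_add, mul_sum]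
  refine sum_congr rfl fun t ht => ?_
  rw [mem_Ioo] at ht
  rw [if_pos rfl]
  by_cases hdvd : 2 * p ∣ t + a + 1
  · have hl := labelAt_of_dvd hp hdvd
    have hc := colorAt_of_dvd hp hdvd
    have h1 : wordTailSum p K d (0 + 1) (colorAt p a) (labelAt p a) t b =
        wordSum p K d (t + 1) b +
          (if labelAt p a ∈ K then 1 else 0) * d (colorAt p a) *
            ∑ s ∈ Ioo t b, if s % (2 * p) = a % (2 * p) then
              wordSum p K d (t + 1) s * wordSum p K d s b else 0 := by
      rw [wordTailSum_eq _ _ _ ht.2, if_pos ⟨hl, hc⟩, if_pos (Or.inr rfl), if_pos hl, one_mul, hc,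
        mul_sum]
      congr 1
      refine sum_congr rfl fun s hs => ?_
      rw [mem_Ioo] at hs
      by_cases hK : labelAt p a ∈ K
      · rw [if_pos hK, wordTailSum_of_mem _ _ hK, one_mul]
        split_ifs with hmod
        · have hcs : colorAt p s = colorAt p a := by unfold colorAt; rw [hmod]
          have hls : labelAt p s = labelAt p a := by unfold labelAt; rw [hmod]
          rw [wordSum_eq_wordTailSum s b, hcs, hls]
          ring
        · rw [mul_zero]
          by_cases hls : labelAt p s = labelAt p a
          · by_cases h0 : wordSum p K d (t + 1) s = 0
            · rw [h0, zero_mul]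
            · have h2 := colorAt_eq_of_wordSum_ne_zero (by omega) h0
              exact absurd (mod_eq_of_labelAt_eq hp hls (h2.symm.trans hc)) hmod
          · rw [wordTailSum_of_labelAt_ne _ _ hs.2 hls, mul_zero, mul_zero]
      · rw [if_neg hK, wordTailSum_two_of_notMem _ hK hs.2]
        simp
    rw [h1, if_pos hdvd]
    ring
  · rw [if_neg hdvd, mul_zero]
    by_cases hl : labelAt p t = labelAt p a
    · by_cases h0 : wordSum p K d (a + 1) t = 0
      · rw [h0, zero_mul]
      · have h2 := colorAt_eq_of_wordSum_ne_zero (by omega) h0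
        exact absurd (dvd_of_labelAt_eq hp hl h2.symm) hdvd
    · rw [wordTailSum_of_labelAt_ne _ _ ht.2 hl, mul_zero, mul_zero]

end Weights

/-! ### Generating functions along the periods of the word -/

section Period

variable {R : Type*} [CommRing R] {p : ℕ} {K : Finset ℕ} {d : ℕ → R}

theorem colorAt_add_period (x : ℕ) : colorAt p (x + 2 * p) = colorAt p x := by
  simp [colorAt]

theorem labelAt_add_period (x : ℕ) : labelAt p (x + 2 * p) = labelAt p x := by
  simp [labelAt]

theorem wordSum_add_period_aux (hp : 1 ≤ p) (m : ℕ) : ∀ a b : ℕ, b - a = m →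
    wordSum p K d (a + 2 * p) (b + 2 * p) = wordSum p K d a b := by
  induction m using Nat.strong_induction_on with
  | _ m ih =>
    intro a b hm
    rcases le_or_gt b a with h | hab
    · rw [wordSum_of_le h, wordSum_of_le (by omega)]
    have ih' : ∀ a' b', a ≤ a' → b' ≤ b → (a < a' ∨ b' < b) →
        wordSum p K d (a' + 2 * p) (b' + 2 * p) = wordSum p K d a' b' := fun a' b' h1 h2 h3 =>
      ih (b' - a') (by omega) a' b' rfl
    rw [wordSum_of_lt hp hab, wordSum_of_lt hp (show a + 2 * p < b + 2 * p by omega),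
      ← map_add_right_Ioo, sum_map, show a + 2 * p + 1 = (a + 1) + 2 * p by ring,
      colorAt_add_period, colorAt_add_period, labelAt_add_period]
    congr 1
    refine sum_congr rfl fun t ht => ?_
    rw [mem_Ioo] at ht
    have hdvd : 2 * p ∣ t + 2 * p + (a + 2 * p) + 1 ↔ 2 * p ∣ t + a + 1 := by
      rw [show t + 2 * p + (a + 2 * p) + 1 = t + a + 1 + 2 * p * 2 by ring]
      exact (Nat.dvd_add_left (dvd_mul_right _ _))
    simp only [addRightEmbedding_apply, hdvd]
    rw [ih' (a + 1) t (by omega) (by omega) (by omega),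
      show t + 2 * p + 1 = (t + 1) + 2 * p by ring, ih' (t + 1) b (by omega) (by omega) (by omega),
      ← map_add_right_Ioo, sum_map]
    have hs : ∑ s ∈ Ioo t b, (if (s + 2 * p) % (2 * p) = (a + 2 * p) % (2 * p) then
          wordSum p K d (t + 1 + 2 * p) (s + 2 * p) * wordSum p K d (s + 2 * p) (b + 2 * p)
        else 0) = ∑ s ∈ Ioo t b, if s % (2 * p) = a % (2 * p) then
          wordSum p K d (t + 1) s * wordSum p K d s b else 0 := by
      refine sum_congr rfl fun s hs => ?_
      rw [mem_Ioo] at hs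
      rw [Nat.add_mod_right, Nat.add_mod_right, ih' (t + 1) s (by omega) (by omega) (by omega),
        ih' s b (by omega) (by omega) (by omega)]
    simp only [addRightEmbedding_apply]
    rw [hs]

theorem wordSum_add_period (hp : 1 ≤ p) (a b : ℕ) :
    wordSum p K d (a + 2 * p) (b + 2 * p) = wordSum p K d a b :=
  wordSum_add_period_aux hp _ a b rfl

/-- The generating function of `A e f, A e (f + N), A e (f + 2N), …`. -/
def periodGF (N : ℕ) (A : ℕ → ℕ → R) (e f : ℕ) : PowerSeries R :=
  PowerSeries.mk fun n => A e (f + N * n)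

theorem sum_range_mul_mod {N r : ℕ} (hr : r < N) (g : ℕ → R) (M : ℕ) :
    ∑ t ∈ range (N * M), (if t % N = r then g t else 0) = ∑ i ∈ range M, g (r + N * i) := by
  induction M with
  | zero => simp
  | succ M ih =>
    rw [mul_add, mul_one, sum_range_add, ih, sum_range_succ]
    congr 1
    rw [sum_eq_single r]
    · rw [Nat.mul_add_mod, Nat.mod_eq_of_lt hr, if_pos rfl, add_comm]
    · intro s hs hsr
      rw [mem_range] at hs
      rw [Nat.mul_add_mod, Nat.mod_eq_of_lt hs, if_neg hsr]
    · intro h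
      exact absurd (mem_range.2 hr) h

/-- Summation over the intermediate legs `t ≡ r` becomes the product of generating functions. -/
theorem coeff_periodGF_mul {N r e f : ℕ} {A B : ℕ → ℕ → R}
    (hB : ∀ a b, B (a + N) (b + N) = B a b) (hB0 : ∀ a b, b ≤ a → B a b = 0)
    (hr : r < N) (hf : f ≤ r + N) (n : ℕ) :
    PowerSeries.coeff n (periodGF N A e r * periodGF N B r f) =
      ∑ t ∈ range (f + N * n), if t % N = r then A e t * B t (f + N * n) else 0 := by
  have hBi : ∀ i a b, B (a + N * i) (b + N * i) = B a b := by
    intro i a b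
    induction i with
    | zero => simp
    | succ i ih => rw [mul_add, mul_one, ← add_assoc, ← add_assoc, hB, ih]
  have h1 : ∑ t ∈ range (f + N * n), (if t % N = r then A e t * B t (f + N * n) else 0) =
      ∑ t ∈ range (N * (f + n + 1)), (if t % N = r then A e t * B t (f + N * n) else 0) := by
    refine sum_subset (range_subset_range.2 ?_) fun t _ ht => ?_
    · have : f ≤ N * f := Nat.le_mul_of_pos_left _ (by omega)
      have : N * (f + n + 1) = N * f + N * n + N := by ring
      omega
    · rw [mem_range, not_lt] at ht
      rw [hB0 _ _ ht, mul_zero, ite_self]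
  rw [h1, sum_range_mul_mod hr (fun t => A e t * B t (f + N * n)), PowerSeries.coeff_mul,
    Nat.sum_antidiagonal_eq_sum_range_succ
      (fun i j => PowerSeries.coeff i (periodGF N A e r) * PowerSeries.coeff j (periodGF N B r f))]
  have h2 : range (n + 1) ⊆ range (f + n + 1) := range_subset_range.2 (by omega)
  rw [← sum_subset h2]
  · refine sum_congr rfl fun i hi => ?_
    rw [mem_range] at hi
    rw [periodGF, periodGF, PowerSeries.coeff_mk, PowerSeries.coeff_mk, ← hBi i r]
    congr 2
    rw [add_assoc, ← mul_add]
    congr 2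
    omega
  · intro i _ hi
    rw [mem_range, not_lt] at hi
    have : N * (n + 1) ≤ N * i := Nat.mul_le_mul_left _ hi
    rw [hB0 _ _ (by rw [mul_add] at this; omega), mul_zero]

variable (p K d)

/-- `Z(a, b)`, extended by zero to `b < a`. -/
noncomputable def segSum (a b : ℕ) : R := if a ≤ b then wordSum p K d a b else 0

/-- `Z(a, b)` on nonempty intervals, extended by zero to `b ≤ a`. -/
noncomputable def segSumPos (a b : ℕ) : R := if a < b then wordSum p K d a b else 0

variable {p K d}

theorem segSum_add_period (hp : 1 ≤ p) (a b : ℕ) :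
    segSum p K d (a + 2 * p) (b + 2 * p) = segSum p K d a b := by
  simp [segSum, wordSum_add_period hp]

theorem segSumPos_add_period (hp : 1 ≤ p) (a b : ℕ) :
    segSumPos p K d (a + 2 * p) (b + 2 * p) = segSumPos p K d a b := by
  simp [segSumPos, wordSum_add_period hp]

theorem segSum_of_le {a b : ℕ} (h : a ≤ b) : segSum p K d a b = wordSum p K d a b := if_pos h

theorem segSum_of_lt {a b : ℕ} (h : b < a) : segSum p K d a b = 0 := if_neg h.not_ge

theorem segSumPos_of_lt {a b : ℕ} (h : a < b) : segSumPos p K d a b = wordSum p K d a b :=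
  if_pos h

theorem segSumPos_of_le {a b : ℕ} (h : b ≤ a) : segSumPos p K d a b = 0 := if_neg h.not_gt

theorem segSum_self (a : ℕ) : segSum p K d a a = 1 := by
  rw [segSum_of_le le_rfl, wordSum_of_le le_rfl]

variable (p K d) in
/-- The total weight of the part of a partition after the second leg of the block of a leg `≡ e`:
either this block is complete, or it is continued at some leg `s ≡ e`. -/
noncomputable def restSum (e a b : ℕ) : R :=
  segSum p K d a b + (if labelAt p e ∈ K then 1 else 0) * d (colorAt p e) *
    ∑ s ∈ range b, if s % (2 * p) = e then segSum p K d a s * segSumPos p K d s b else 0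

theorem restSum_add_period (hp : 1 ≤ p) (e a b : ℕ) :
    restSum p K d e (a + 2 * p) (b + 2 * p) = restSum p K d e a b := by
  unfold restSum
  rw [segSum_add_period hp, add_comm b, sum_range_add, sum_eq_zero (s := range (2 * p)), zero_add]
  · congr 2
    refine sum_congr rfl fun s _ => ?_
    rw [Nat.add_mod_left, add_comm _ s, add_comm _ b, segSum_add_period hp, segSumPos_add_period hp]
  · intro s hs
    rw [mem_range] at hs
    rw [segSum_of_lt (by omega), zero_mul, ite_self]

/-- The recursion `wordSum_of_lt`, with the range conditions absorbed into the summands. -/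
theorem segSumPos_eq (hp : 1 ≤ p) {e : ℕ} (he : e < 2 * p) (b : ℕ) :
    segSumPos p K d e b = d (colorAt p (e + 1)) * ∑ t ∈ range b, if t % (2 * p) = 2 * p - 1 - e then
      segSum p K d (e + 1) t * restSum p K d e (t + 1) b else 0 := by
  have hem : e % (2 * p) = e := Nat.mod_eq_of_lt he
  rcases le_or_gt b e with h | hab
  · rw [segSumPos_of_le (by omega), sum_eq_zero, mul_zero]
    intro t ht
    rw [mem_range] at ht
    rw [segSum_of_lt (by omega), zero_mul, ite_self]
  rw [segSumPos_of_lt hab, wordSum_of_lt hp hab]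
  congr 1
  have hsub : Ioo e b ⊆ range b := fun t ht => mem_range.2 (mem_Ioo.1 ht).2
  rw [← sum_subset hsub]
  · refine sum_congr rfl fun t ht => ?_
    rw [mem_Ioo] at ht
    have hiff : 2 * p ∣ t + e + 1 ↔ t % (2 * p) = 2 * p - 1 - e := by
      rw [dvd_add_succ_iff hp, hem]
      omega
    simp only [hiff]
    rw [restSum, segSum_of_le (show e + 1 ≤ t by omega), segSum_of_le (show t + 1 ≤ b by omega)]
    have hs : ∑ s ∈ range b, (if s % (2 * p) = e then
          segSum p K d (t + 1) s * segSumPos p K d s b else 0) =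
        ∑ s ∈ Ioo t b, if s % (2 * p) = e % (2 * p) then
          wordSum p K d (t + 1) s * wordSum p K d s b else 0 := by
      have hsub : Ioo t b ⊆ range b := fun s hs => mem_range.2 (mem_Ioo.1 hs).2
      rw [← sum_subset hsub]
      · refine sum_congr rfl fun s hs => ?_
        rw [mem_Ioo] at hs
        rw [hem, segSum_of_le (by omega), segSumPos_of_lt hs.2]
      · intro s _ hs
        rw [mem_Ioo] at hs
        rcases lt_or_ge s b with h' | h'
        · rw [segSum_of_lt (by omega), zero_mul, ite_self]
        · rw [segSumPos_of_le (by omega), mul_zero, ite_self]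
    rw [hs]
  · intro t ht ht'
    rw [mem_Ioo] at ht'
    rw [mem_range] at ht
    rw [segSum_of_lt (by omega), zero_mul, ite_self]

/-- The recursion for the total weights in terms of generating functions. -/
theorem periodGF_segSumPos (hp : 1 ≤ p) {e f : ℕ} (he : e < 2 * p) (hf : f ≤ e + 2 * p)
    (hf' : f ≤ 2 * p - 1 - e + 2 * p) :
    periodGF (2 * p) (segSumPos p K d) e f =
      PowerSeries.C (d (colorAt p (e + 1))) *
        periodGF (2 * p) (segSum p K d) (e + 1) (2 * p - 1 - e) *
        (periodGF (2 * p) (segSum p K d) (2 * p - e) f +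
          (if labelAt p e ∈ K then 1 else 0) * PowerSeries.C (d (colorAt p e)) *
            periodGF (2 * p) (segSum p K d) (2 * p - e) e *
            periodGF (2 * p) (segSumPos p K d) e f) := by
  have h1 : periodGF (2 * p) (restSum p K d e) (2 * p - e) f =
      periodGF (2 * p) (segSum p K d) (2 * p - e) f +
          (if labelAt p e ∈ K then 1 else 0) * PowerSeries.C (d (colorAt p e)) *
            periodGF (2 * p) (segSum p K d) (2 * p - e) e *
            periodGF (2 * p) (segSumPos p K d) e f := by
    ext n
    have h0 : (if labelAt p e ∈ K then 1 else 0 : PowerSeries R) =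
        PowerSeries.C (if labelAt p e ∈ K then 1 else 0) := by split_ifs <;> simp
    rw [h0, ← map_mul, mul_assoc, map_add, PowerSeries.coeff_C_mul,
      coeff_periodGF_mul (segSumPos_add_period hp)
        (fun a b h => by rw [segSumPos_of_le h]) he hf]
    simp [periodGF, restSum]
  have h2 : periodGF (2 * p) (restSum p K d e) (2 * p - e) f =
      periodGF (2 * p) (fun a b => restSum p K d e (a + 1) b) (2 * p - 1 - e) f := by
    ext n
    simp only [periodGF, PowerSeries.coeff_mk]
    congr 1
    omega
  rw [← h1, h2]
  ext n
  rw [mul_assoc, PowerSeries.coeff_C_mul, coeff_periodGF_mul (fun a b => by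
      rw [show a + 2 * p + 1 = a + 1 + 2 * p by ring, restSum_add_period hp])
    (fun a b h => ?_) (by omega) hf', periodGF, PowerSeries.coeff_mk, segSumPos_eq hp he]
  rw [restSum, segSum_of_lt (by omega), sum_eq_zero, mul_zero, add_zero]
  intro s hs
  rw [mem_range] at hs
  rw [segSum_of_lt (by omega), zero_mul, ite_self]

variable (p K d)

/-- The generating function of the stretches which start at leg `e` and end at a mirror image
of `e`, i.e. before a leg `≡ -e` modulo `2p`. -/
noncomputable def mirrorGF (e : ℕ) : PowerSeries R := periodGF (2 * p) (segSum p K d) e (2 * p - e)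

/-- The generating function of the stretches which consist of full periods, starting at `e`. -/
noncomputable def loopGF (e : ℕ) : PowerSeries R := periodGF (2 * p) (segSum p K d) e e

variable {p K d}

theorem coeff_loopGF_zero (n : ℕ) :
    PowerSeries.coeff n (loopGF p K d 0) = wordSum p K d 0 (2 * p * n) := by
  simp [loopGF, periodGF, segSum]

theorem loopGF_ne_zero [Nontrivial R] (e : ℕ) : loopGF p K d e ≠ 0 := by
  intro h
  have := congrArg (PowerSeries.coeff 0) h
  simp [loopGF, periodGF, segSum_self] at this

theorem mirrorGF_self : mirrorGF p K d p = loopGF p K d p := by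
  rw [mirrorGF, loopGF, two_mul, Nat.add_sub_cancel]

/-- A stretch from leg `2p` to some leg `≡ 0` is a loop at `0`; its period count is one higher
since the mirror image `2p - 2p = 0` of leg `2p` lies one period before it. -/
theorem mirrorGF_period (hp : 1 ≤ p) :
    mirrorGF p K d (2 * p) = PowerSeries.X * loopGF p K d 0 := by
  ext n
  rw [mirrorGF, loopGF, periodGF, periodGF, PowerSeries.coeff_mk]
  cases n with
  | zero => simp [segSum]; omega
  | succ n =>
    rw [PowerSeries.coeff_succ_X_mul, PowerSeries.coeff_mk, ← segSum_add_period hp 0]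
    congr 1
    · ring
    · rw [Nat.sub_self]; ring

theorem loopGF_eq (hp : 1 ≤ p) {e : ℕ} (he : e < 2 * p) :
    loopGF p K d e - 1 = PowerSeries.C (d (colorAt p (e + 1))) * mirrorGF p K d (e + 1) *
      (mirrorGF p K d (2 * p - e) + (if labelAt p e ∈ K then 1 else 0) *
        PowerSeries.C (d (colorAt p e)) * mirrorGF p K d (2 * p - e) *
          (loopGF p K d e - 1)) := by
  have h1 : loopGF p K d e - 1 = periodGF (2 * p) (segSumPos p K d) e e := by
    ext n
    rw [map_sub, loopGF, periodGF, periodGF, PowerSeries.coeff_mk, PowerSeries.coeff_mk,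
      PowerSeries.coeff_one]
    rcases Nat.eq_zero_or_pos n with rfl | hn
    · simp [segSum_self, segSumPos]
    · have : 0 < 2 * p * n := by positivity
      rw [segSum_of_le (by omega), segSumPos_of_lt (by omega), if_neg hn.ne', sub_zero]
  have h2 : mirrorGF p K d (2 * p - e) = periodGF (2 * p) (segSum p K d) (2 * p - e) e := by
    rw [mirrorGF, Nat.sub_sub_self he.le]
  rw [h1, h2, mirrorGF, show 2 * p - (e + 1) = 2 * p - 1 - e by omega]
  exact periodGF_segSumPos hp he (by omega) (by omega)

theorem mirrorGF_eq (hp : 1 ≤ p) {e : ℕ} (he0 : 0 < e) (he : e < 2 * p) (hep : e ≠ p) :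
    mirrorGF p K d e = PowerSeries.C (d (colorAt p (e + 1))) * mirrorGF p K d (e + 1) *
      (loopGF p K d (2 * p - e) + (if labelAt p e ∈ K then 1 else 0) *
        PowerSeries.C (d (colorAt p e)) * mirrorGF p K d (2 * p - e) * mirrorGF p K d e) := by
  have h1 : mirrorGF p K d e = periodGF (2 * p) (segSumPos p K d) e (2 * p - e) := by
    ext n
    rw [mirrorGF, periodGF, periodGF, PowerSeries.coeff_mk, PowerSeries.coeff_mk]
    have : e ≠ 2 * p - e + 2 * p * n := by
      rcases Nat.eq_zero_or_pos n with rfl | hn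
      · omega
      · have : 2 * p ≤ 2 * p * n := Nat.le_mul_of_pos_right _ hn
        omega
    rw [segSum, segSumPos]
    split_ifs <;> first | rfl | omega
  have h2 : mirrorGF p K d (2 * p - e) = periodGF (2 * p) (segSum p K d) (2 * p - e) e := by
    rw [mirrorGF, Nat.sub_sub_self he.le]
  rw [h2, h1, mirrorGF, loopGF, show 2 * p - (e + 1) = 2 * p - 1 - e by omega]
  exact periodGF_segSumPos hp he (by omega) (by omega)

end Period

/-! ### The functional equation -/

section FunctionalEquation

variable {R : Type*} [CommRing R] {p : ℕ} {K : Finset ℕ} {d : ℕ → R}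

theorem colorAt_mirror {e : ℕ} (he0 : 0 < e) (he : e < 2 * p) :
    colorAt p (2 * p - e) = colorAt p e := by
  unfold colorAt
  rw [Nat.mod_eq_of_lt he, Nat.mod_eq_of_lt (by omega)]
  omega

theorem labelAt_mirror {e : ℕ} (he : e < 2 * p) : labelAt p (2 * p - 1 - e) = labelAt p e := by
  unfold labelAt
  rw [Nat.mod_eq_of_lt he, Nat.mod_eq_of_lt (by omega)]
  omega

theorem colorAt_of_le (hp : 1 ≤ p) {c : ℕ} (hc : c ≤ p) : colorAt p c = c := by
  unfold colorAt
  rw [Nat.mod_eq_of_lt (by omega)]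
  omega

theorem labelAt_of_lt {c : ℕ} (hc : c < p) : labelAt p c = c := by
  unfold labelAt
  rw [Nat.mod_eq_of_lt (by omega)]
  omega

theorem colorAt_le (p x : ℕ) : colorAt p x ≤ p := by
  unfold colorAt
  omega

variable (p d) in
/-- The variable `d` of the color before leg `e`, as a constant power series. -/
noncomputable def colorVar (e : ℕ) : PowerSeries R := PowerSeries.C (d (colorAt p e))

variable (p K) in
/-- `1` for the free Poisson labels, `0` for the semicircle labels. -/
noncomputable def poissonInd (e : ℕ) : PowerSeries R := if labelAt p e ∈ K then 1 else 0

variable (p K d) in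
/-- The weight of one turn of the block of leg `e`: two legs and the two stretches after them. -/
noncomputable def turnGF (e : ℕ) : PowerSeries R :=
  colorVar p d e * colorVar p d (e + 1) * mirrorGF p K d (e + 1) * mirrorGF p K d (2 * p - e)

theorem colorVar_ne_zero (hd : ∀ c ≤ p, d c ≠ 0) (e : ℕ) : colorVar p d e ≠ 0 := by
  intro h
  have := congrArg (PowerSeries.coeff 0) h
  simp only [colorVar, PowerSeries.coeff_zero_C, map_zero] at this
  exact hd _ (colorAt_le p e) this

variable (p K d) in
/-- The series `d_c (F_c - 1)`, which turns out not to depend on the leg `e`, with color `c`. -/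
noncomputable def scaledLoopGF (e : ℕ) : PowerSeries R := colorVar p d e * (loopGF p K d e - 1)

theorem scaledLoopGF_mul (hp : 1 ≤ p) {e : ℕ} (he : e < 2 * p) :
    scaledLoopGF p K d e * (1 - poissonInd p K e * turnGF p K d e) = turnGF p K d e := by
  have h := loopGF_eq (K := K) (d := d) hp he
  unfold scaledLoopGF turnGF poissonInd
  change _ = colorVar p d (e + 1) * _ * (_ + _ * colorVar p d e * _ * _) at h
  linear_combination colorVar p d e * h

theorem turnGF_mirror {e : ℕ} (he : e < 2 * p) :
    turnGF p K d (2 * p - 1 - e) = turnGF p K d e := by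
  have h1 : colorVar p d (2 * p - 1 - e) = colorVar p d (e + 1) := by
    unfold colorVar
    by_cases h : e + 1 = 2 * p
    · have : colorAt p (2 * p) = colorAt p 0 := by simp [colorAt]
      rw [h, show 2 * p - 1 - e = 0 by omega, this]
    · rw [← colorAt_mirror (show 0 < e + 1 by omega) (by omega),
        show 2 * p - 1 - e = 2 * p - (e + 1) by omega]
  have h2 : colorVar p d (2 * p - e) = colorVar p d e := by
    unfold colorVar
    rcases Nat.eq_zero_or_pos e with rfl | h
    · simp [colorAt]
    · rw [colorAt_mirror h he]
  unfold turnGF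
  rw [h1, show 2 * p - 1 - e + 1 = 2 * p - e by omega, h2,
    show 2 * p - (2 * p - 1 - e) = e + 1 by omega]
  ring

variable [IsDomain R]

/-- Descending from `2p` to `1`, with new starts at the color extrema `2p` and `p`. -/
theorem mirrorGF_ne_zero (hp : 1 ≤ p) (hd : ∀ c ≤ p, d c ≠ 0) {e : ℕ} (he0 : 0 < e)
    (he : e ≤ 2 * p) : mirrorGF p K d e ≠ 0 := by
  suffices h : ∀ m, m < 2 * p → mirrorGF p K d (2 * p - m) ≠ 0 by
    have := h (2 * p - e) (by omega)
    rwa [Nat.sub_sub_self he] at this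
  intro m hm
  induction m with
  | zero =>
    rw [Nat.sub_zero, mirrorGF_period hp]
    exact mul_ne_zero PowerSeries.X_ne_zero (loopGF_ne_zero 0)
  | succ m ih =>
    by_cases hmp : 2 * p - (m + 1) = p
    · rw [hmp, mirrorGF_self]
      exact loopGF_ne_zero p
    · intro h0
      have h := mirrorGF_eq (K := K) (d := d) hp (show 0 < 2 * p - (m + 1) by omega)
        (by omega) hmp
      rw [h0, mul_zero, add_zero, show 2 * p - (m + 1) + 1 = 2 * p - m by omega] at h
      exact mul_ne_zero (mul_ne_zero (colorVar_ne_zero hd (2 * p - m)) (ih (by omega)))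
        (loopGF_ne_zero _) h.symm

theorem one_sub_turnGF_ne_zero (hp : 1 ≤ p) {e : ℕ} (he : e < 2 * p) :
    1 - poissonInd p K e * turnGF p K d e ≠ 0 := by
  intro h0
  have h := scaledLoopGF_mul (K := K) (d := d) hp he
  rw [h0, mul_zero] at h
  rw [← h, mul_zero, sub_zero] at h0
  exact one_ne_zero h0

theorem scaledLoopGF_mirror (hp : 1 ≤ p) {e : ℕ} (he : e < 2 * p) :
    scaledLoopGF p K d (2 * p - 1 - e) = scaledLoopGF p K d e := by
  have h1 := scaledLoopGF_mul (K := K) (d := d) hp he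
  have h2 := scaledLoopGF_mul (K := K) (d := d) hp (show 2 * p - 1 - e < 2 * p by omega)
  rw [turnGF_mirror he, poissonInd, labelAt_mirror he] at h2
  exact mul_right_cancel₀ (one_sub_turnGF_ne_zero hp he) (h2.trans h1.symm)

/-- `(F_e - 1) F_{-e} = Y_e Y_{-e}`, as the loops at `e` and the stretches from `e` to `-e` obey
the same recursion with different initial terms. -/
theorem loopGF_mul_mirror (hp : 1 ≤ p) (hd : ∀ c ≤ p, d c ≠ 0) {e : ℕ} (he0 : 0 < e)
    (he : e < 2 * p) (hep : e ≠ p) :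
    (loopGF p K d e - 1) * loopGF p K d (2 * p - e) =
      mirrorGF p K d e * mirrorGF p K d (2 * p - e) := by
  have h1 := loopGF_eq (K := K) (d := d) hp he
  have h2 := mirrorGF_eq (K := K) (d := d) hp he0 he hep
  change _ = colorVar p d (e + 1) * _ * (_ + poissonInd p K e * colorVar p d e * _ * _) at h1
  change _ = colorVar p d (e + 1) * _ * (_ + poissonInd p K e * colorVar p d e * _ * _) at h2
  have h3 : colorVar p d (e + 1) * mirrorGF p K d (e + 1) ≠ 0 :=
    mul_ne_zero (colorVar_ne_zero hd _) (mirrorGF_ne_zero hp hd (by omega) (by omega))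
  refine mul_left_cancel₀ h3 ?_
  linear_combination mirrorGF p K d e * h1 - (loopGF p K d e - 1) * h2

theorem loopGF_mirror (hp : 1 ≤ p) (hd : ∀ c ≤ p, d c ≠ 0) {e : ℕ} (he0 : 0 < e)
    (he : e < 2 * p) : loopGF p K d (2 * p - e) = loopGF p K d e := by
  by_cases hep : e = p
  · rw [hep, two_mul, Nat.add_sub_cancel]
  have h1 := loopGF_mul_mirror (K := K) hp hd he0 he hep
  have h2 := loopGF_mul_mirror (K := K) hp hd (show 0 < 2 * p - e by omega) (by omega)
    (show 2 * p - e ≠ p by omega)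
  rw [Nat.sub_sub_self he.le] at h2
  linear_combination h2 - h1

theorem scaledLoopGF_eq (hp : 1 ≤ p) (hd : ∀ c ≤ p, d c ≠ 0) {e : ℕ} (he : e < 2 * p) :
    scaledLoopGF p K d e = scaledLoopGF p K d 0 := by
  induction e with
  | zero => rfl
  | succ e ih =>
    rw [← ih (by omega), ← scaledLoopGF_mirror hp (show e < 2 * p by omega),
      show 2 * p - 1 - e = 2 * p - (e + 1) by omega, scaledLoopGF, scaledLoopGF,
      loopGF_mirror hp hd (by omega) he, colorVar, colorVar, colorAt_mirror (by omega) he]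

theorem mirrorGF_mul_mirrorGF (hp : 1 ≤ p) (hd : ∀ c ≤ p, d c ≠ 0) {c : ℕ} (hc0 : 0 < c)
    (hc : c < p) :
    colorVar p d c ^ 2 * (mirrorGF p K d c * mirrorGF p K d (2 * p - c)) =
      (colorVar p d c + scaledLoopGF p K d 0) * scaledLoopGF p K d 0 := by
  rw [← loopGF_mul_mirror hp hd hc0 (by omega) (by omega), loopGF_mirror hp hd hc0 (by omega),
    ← scaledLoopGF_eq hp hd (show c < 2 * p by omega), scaledLoopGF]
  ring

theorem colorVar_mul_loopGF (hp : 1 ≤ p) (hd : ∀ c ≤ p, d c ≠ 0) {e : ℕ} (he : e < 2 * p) :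
    colorVar p d e * loopGF p K d e = colorVar p d e + scaledLoopGF p K d 0 := by
  rw [← scaledLoopGF_eq hp hd he, scaledLoopGF]
  ring

/-- The product of the turn weights over all labels: the factors `Y_c Y_{-c}` of neighboring labels
combine. -/
theorem prod_turnGF (hp : 1 ≤ p) (hd : ∀ c ≤ p, d c ≠ 0) :
    ∏ c ∈ range p, turnGF p K d c = PowerSeries.X * scaledLoopGF p K d 0 ^ (p - 1) *
      ∏ c ∈ range (p + 1), (colorVar p d c + scaledLoopGF p K d 0) := by
  obtain ⟨p', rfl⟩ := Nat.exists_eq_add_of_le' hp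
  set p := p' + 1 with hp'
  have h1 : ∏ c ∈ range p, turnGF p K d c =
      colorVar p d 0 * mirrorGF p K d (2 * p) * (colorVar p d p * mirrorGF p K d p) *
        ∏ c ∈ range p', colorVar p d (c + 1) ^ 2 *
          (mirrorGF p K d (c + 1) * mirrorGF p K d (2 * p - (c + 1))) := by
    simp only [turnGF, prod_mul_distrib]
    rw [hp', prod_range_succ' (fun c => colorVar (p' + 1) d c),
      prod_range_succ (fun c => colorVar (p' + 1) d (c + 1)),
      prod_range_succ (fun c => mirrorGF (p' + 1) K d (c + 1)),
      prod_range_succ' (fun c => mirrorGF (p' + 1) K d (2 * (p' + 1) - c)), prod_pow,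
      Nat.sub_zero]
    ring
  rw [h1, prod_congr rfl fun c hc => mirrorGF_mul_mirrorGF hp hd (Nat.succ_pos c)
    (show c + 1 < p by rw [mem_range] at hc; omega), mirrorGF_self, mirrorGF_period hp,
    colorVar_mul_loopGF hp hd (by omega), mul_left_comm, colorVar_mul_loopGF hp hd (by omega),
    prod_mul_distrib, prod_const, card_range, prod_range_succ, hp', prod_range_succ',
    Nat.add_sub_cancel]
  ring

/-- `P = d_0 (F_0 - 1)` satisfies `P = z (1 + P)^q ∏_c (d_c + P)`. -/
theorem scaledLoopGF_functional_equation (hp : 1 ≤ p) (hd : ∀ c ≤ p, d c ≠ 0)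
    (hK : K ⊆ range p) :
    scaledLoopGF p K d 0 = PowerSeries.X * ((1 + scaledLoopGF p K d 0) ^ K.card *
      ∏ c ∈ range (p + 1), (PowerSeries.C (d c) + scaledLoopGF p K d 0)) := by
  have hvar : ∏ c ∈ range (p + 1), (PowerSeries.C (d c) + scaledLoopGF p K d 0) =
      ∏ c ∈ range (p + 1), (colorVar p d c + scaledLoopGF p K d 0) := by
    refine prod_congr rfl fun c hc => ?_
    rw [mem_range] at hc
    rw [colorVar, colorAt_of_le hp (by omega)]
  have hturn : ∀ c ∈ range p, turnGF p K d c * (if c ∈ K then 1 + scaledLoopGF p K d 0 else 1) =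
      scaledLoopGF p K d 0 := fun c hc => by
    rw [mem_range] at hc
    have h := scaledLoopGF_mul (K := K) (d := d) hp (show c < 2 * p by omega)
    rw [scaledLoopGF_eq hp hd (by omega), poissonInd, labelAt_of_lt hc] at h
    split_ifs at h ⊢ <;> linear_combination -h
  have hpow : scaledLoopGF p K d 0 ^ p =
      (∏ c ∈ range p, turnGF p K d c) * (1 + scaledLoopGF p K d 0) ^ K.card := by
    have h1 := prod_congr rfl hturn
    rw [prod_mul_distrib, prod_const, card_range, prod_ite_mem, inter_eq_right.2 hK,
      prod_const] at h1
    exact h1.symm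
  have hne : scaledLoopGF p K d 0 ≠ 0 := by
    intro h0
    have h := scaledLoopGF_mul (K := K) (d := d) hp (show 0 < 2 * p by omega)
    rw [h0, zero_mul] at h
    refine mul_ne_zero (mul_ne_zero (mul_ne_zero (colorVar_ne_zero hd 0) (colorVar_ne_zero hd _))
      (mirrorGF_ne_zero hp hd (by omega) (by omega)))
      (mirrorGF_ne_zero hp hd (by omega) (by omega)) h.symm
  refine mul_right_cancel₀ (pow_ne_zero (p - 1) hne) ?_
  rw [← pow_succ', Nat.sub_add_cancel hp, hpow, prod_turnGF hp hd, hvar]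
  ring

end FunctionalEquation

/-! ### Noncrossing partitions of `Fin n` -/

section Transfer

variable {n : ℕ}

/-- A set of legs as a set of natural numbers. -/
def natBlock (V : Finset (Fin n)) : Finset ℕ := V.map Fin.valEmbedding

theorem mem_natBlock {V : Finset (Fin n)} {x : ℕ} : x ∈ natBlock V ↔ ∃ h : x < n, ⟨x, h⟩ ∈ V := by
  simp only [natBlock, mem_map, Fin.valEmbedding_apply]
  constructor
  · rintro ⟨s, hs, rfl⟩
    exact ⟨s.2, hs⟩
  · rintro ⟨h, hs⟩
    exact ⟨_, hs, rfl⟩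

theorem val_mem_natBlock {V : Finset (Fin n)} {s : Fin n} : (s : ℕ) ∈ natBlock V ↔ s ∈ V := by
  simp [mem_natBlock]

theorem natBlock_injective : Function.Injective (natBlock : Finset (Fin n) → Finset ℕ) :=
  map_injective _

theorem prod_natBlock {R : Type*} [CommMonoid R] (V : Finset (Fin n)) (f : ℕ → R) :
    ∏ s ∈ natBlock V, f s = ∏ s ∈ V, f s := by
  rw [natBlock, prod_map]
  rfl

theorem isNCPartition_natBlock {π : Finpartition (univ : Finset (Fin n))}
    (hπ : IsNoncrossing π) : IsNCPartition (Ico 0 n) (π.parts.image natBlock) := by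
  refine ⟨?_, fun x => ?_, ?_, ?_⟩
  · simp only [forall_mem_image]
    intro V hV
    exact (π.nonempty_of_mem_parts hV).map
  · simp only [exists_mem_image, mem_natBlock, mem_Ico, Nat.zero_le, true_and]
    constructor
    · intro hx
      obtain ⟨V, hV, hxV⟩ := π.exists_mem (mem_univ (⟨x, hx⟩ : Fin n))
      exact ⟨V, hV, hx, hxV⟩
    · rintro ⟨V, -, hx, -⟩
      exact hx
  · simp only [forall_mem_image, mem_natBlock]
    rintro V hV V' hV' x ⟨_, hx⟩ ⟨_, hx'⟩
    rw [π.eq_of_mem_parts hV hV' hx hx']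
  · simp only [forall_mem_image, mem_natBlock]
    rintro V hV V' hV' x y z w hxy hyz hzw ⟨_, hx⟩ ⟨_, hz⟩ ⟨_, hy⟩ ⟨_, hw⟩
    rw [hπ V hV V' hV' _ _ _ _ (Fin.mk_lt_mk.2 hxy) (Fin.mk_lt_mk.2 hyz) (Fin.mk_lt_mk.2 hzw)
      hx hz hy hw]

theorem exists_finpartition {P : Finset (Finset ℕ)} (hP : IsNCPartition (Ico 0 n) P) :
    ∃ π : Finpartition (univ : Finset (Fin n)), IsNoncrossing π ∧ π.parts.image natBlock = P := by
  classical
  set parts : Finset (Finset (Fin n)) := {V | natBlock V ∈ P} with hparts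
  have hmem : ∀ V, V ∈ parts ↔ natBlock V ∈ P := fun V => by simp [hparts]
  have hsurj : ∀ W ∈ P, ∃ V : Finset (Fin n), natBlock V = W := by
    intro W hW
    refine ⟨({s | (s : ℕ) ∈ W} : Finset (Fin n)), ?_⟩
    ext x
    rw [mem_natBlock]
    simp only [mem_filter, mem_univ, true_and]
    refine ⟨fun ⟨_, h⟩ => h, fun h => ⟨?_, h⟩⟩
    exact (mem_Ico.1 (mem_of_isNCPartition hP hW h)).2
  refine ⟨Finpartition.ofExistsUnique parts (fun V _ => subset_univ V) ?_ ?_, ?_, ?_⟩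
  · intro s _
    obtain ⟨W, hW, hs⟩ := (hP.mem_iff s).1 (mem_Ico.2 ⟨Nat.zero_le _, s.2⟩)
    obtain ⟨V, rfl⟩ := hsurj W hW
    refine ⟨V, ⟨(hmem V).2 hW, val_mem_natBlock.1 hs⟩, ?_⟩
    rintro V' ⟨hV', hs'⟩
    exact natBlock_injective
      (hP.eq_of_mem _ ((hmem V').1 hV') _ hW s (val_mem_natBlock.2 hs') hs)
  · intro h
    obtain ⟨x, hx⟩ := hP.nonempty _ ((hmem ∅).1 h)
    simp [natBlock] at hx
  · intro V hV V' hV' a b c d hab hbc hcd ha hc hb hd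
    exact natBlock_injective (hP.noncrossing _ ((hmem V).1 hV) _ ((hmem V').1 hV') a b c d
      hab hbc hcd (val_mem_natBlock.2 ha) (val_mem_natBlock.2 hc) (val_mem_natBlock.2 hb)
      (val_mem_natBlock.2 hd))
  · ext W
    simp only [Finpartition.ofExistsUnique, mem_image]
    constructor
    · rintro ⟨V, hV, rfl⟩
      exact (hmem V).1 hV
    · intro hW
      obtain ⟨V, rfl⟩ := hsurj W hW
      exact ⟨V, (hmem V).2 hW, rfl⟩

open scoped Classical in
theorem ncSum_eq_sum_finpartition {R : Type*} [CommRing R] (w : Finset ℕ → R) (n : ℕ) :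
    ncSum w 0 n = ∑ π : Finpartition (univ : Finset (Fin n)) with IsNoncrossing π,
      ∏ V ∈ π.parts, w (natBlock V) := by
  rw [ncSum_eq]
  symm
  refine sum_bij (fun π _ => π.parts.image natBlock) ?_ ?_ ?_ ?_
  · intro π hπ
    exact mem_ncPartitions.2 (isNCPartition_natBlock (mem_filter.1 hπ).2)
  · intro π _ π' _ h
    exact Finpartition.ext (image_injective natBlock_injective h)
  · intro P hP
    obtain ⟨π, hπ, h⟩ := exists_finpartition (mem_ncPartitions.1 hP)
    exact ⟨π, mem_filter.2 ⟨mem_univ _, hπ⟩, h⟩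
  · intro π _
    rw [prod_image natBlock_injective.injOn]

end Transfer

/-! ### The weighted count as a coefficient -/

section Count

variable {p k : ℕ}

theorem coe_wordLetter (s : Fin (2 * p * k)) : ((wordLetter p k s).1 : ℕ) = labelAt p s := by
  have hp : 0 < p := Nat.pos_of_ne_zero fun h0 => by subst h0; exact absurd s.2 (by simp)
  have h := Nat.mod_lt (s : ℕ) (show 2 * p > 0 by omega)
  unfold wordLetter labelAt
  split_ifs with h1
  · dsimp only
    omega
  · dsimp only
    omega

theorem coe_colorBefore (s : Fin (2 * p * k)) :
    (colorBefore (wordLetter p k s) : ℕ) = colorAt p s := by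
  have hp : 0 < p := Nat.pos_of_ne_zero fun h0 => by subst h0; exact absurd s.2 (by simp)
  have h := Nat.mod_lt (s : ℕ) (show 2 * p > 0 by omega)
  unfold wordLetter colorAt
  split_ifs with h1
  · simp only [colorBefore, Fin.val_castSucc]
    omega
  · simp only [colorBefore, Fin.val_succ]
    omega

theorem coe_colorAfter (s : Fin (2 * p * k)) :
    (colorAfter (wordLetter p k s) : ℕ) = colorAt p (s + 1) := by
  have hp : 0 < p := Nat.pos_of_ne_zero fun h0 => by subst h0; exact absurd s.2 (by simp)
  have h := Nat.mod_lt (s : ℕ) (show 2 * p > 0 by omega)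
  rw [colorAt_succ hp]
  unfold wordLetter
  split_ifs with h1
  · simp only [colorAfter, Fin.val_succ]
    omega
  · simp only [colorAfter, Fin.val_castSucc]
    omega

/-- The variables `d_c` indexed by natural numbers; the value at `c > p` is irrelevant. -/
noncomputable def dimVar (p c : ℕ) : MvPolynomial (Fin (p + 1)) ℝ :=
  if h : c < p + 1 then MvPolynomial.X ⟨c, h⟩ else 1

theorem dimVar_coe (c : Fin (p + 1)) : dimVar p c = MvPolynomial.X c := by
  rw [dimVar, dif_pos c.2]

theorem dimVar_ne_zero (p c : ℕ) : dimVar p c ≠ 0 := by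
  unfold dimVar
  split_ifs
  · exact MvPolynomial.X_ne_zero _
  · exact one_ne_zero

/-- The monomial `d(V)`. -/
theorem prod_dimVar (V : Finset (Fin (2 * p * k))) :
    (∏ s ∈ natBlock V, if ∃ t ∈ natBlock V, s < t then dimVar p (colorAt p (s + 1)) else 1) =
      MvPolynomial.monomial (Finsupp.equivFunOnFinite.symm (blockDimExponent p k V)) 1 := by
  have h1 : ∀ s : Fin (2 * p * k), (∃ t ∈ natBlock V, (s : ℕ) < t) ↔ ∃ t ∈ V, s < t := by
    intro s
    simp [natBlock]
  rw [prod_natBlock, MvPolynomial.monomial_eq, map_one, one_mul,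
    Finsupp.prod_fintype _ _ (by simp)]
  simp only [h1, Finsupp.equivFunOnFinite_symm_apply_apply, blockDimExponent]
  rw [← prod_filter]
  have h2 : ∀ i : Fin (p + 1), (MvPolynomial.X i : MvPolynomial (Fin (p + 1)) ℝ) ^
      (V.filter fun s => (∃ t ∈ V, s < t) ∧ colorAfter (wordLetter p k s) = i).card =
      ∏ s ∈ (V.filter fun s => ∃ t ∈ V, s < t) with colorAfter (wordLetter p k s) = i,
        MvPolynomial.X (colorAfter (wordLetter p k s)) := by
    intro i
    rw [filter_filter, prod_congr rfl fun s hs => by rw [(mem_filter.1 hs).2.2], prod_const]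
  simp only [h2]
  rw [prod_fiberwise]
  refine prod_congr rfl fun s _ => ?_
  rw [← coe_colorAfter, dimVar_coe]

/-- A block is adapted to the word if it is both label adapted and color adapted. -/
def IsAdaptedBlock {U : Type*} (p k : ℕ) (u : Fin p → U) (V : Finset (Fin (2 * p * k)))
    (hV : V.Nonempty) : Prop :=
  (∀ s ∈ V, ∀ t ∈ V, u (wordLetter p k s).1 = u (wordLetter p k t).1) ∧
    colorBefore (wordLetter p k (V.min' hV)) = colorAfter (wordLetter p k (V.max' hV))

open scoped Classical in
theorem blockWeight_natBlock {U : Type*} {u : Fin p → U} (hu : Function.Injective u)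
    {ν : U → MeasureTheory.Measure ℝ} {K : Finset (Fin p)}
    (hpoisson : ∀ i ∈ K, ν (u i) = freePoissonLaw)
    (hsemicircle : ∀ i ∉ K, ν (u i) = semicircleLaw)
    (V : Finset (Fin (2 * p * k))) (hV : V.Nonempty) :
    blockWeight p (K.map Fin.valEmbedding) (dimVar p) (natBlock V) =
      if IsAdaptedBlock p k u V hV then
        MvPolynomial.monomial (Finsupp.equivFunOnFinite.symm (blockDimExponent p k V))
          (freeCumulant (ν (u (wordLetter p k (V.min' hV)).1)) V.card)
      else 0 := by
  set a := V.min' hV with ha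
  have haV : a ∈ V := min'_mem _ _
  rw [blockWeight_eq (a := a) (val_mem_natBlock.2 haV) fun x hx => by
    obtain ⟨h, hx⟩ := mem_natBlock.1 hx
    exact Fin.le_def.1 (min'_le V _ hx)]
  have hcard : (natBlock V).card = V.card := card_map _
  have hlab : (∀ s ∈ natBlock V, labelAt p s = labelAt p a) ↔
      ∀ s ∈ V, ∀ t ∈ V, u (wordLetter p k s).1 = u (wordLetter p k t).1 := by
    constructor
    · intro h s hs t ht
      congr 1
      apply Fin.ext
      rw [coe_wordLetter, coe_wordLetter, h s (val_mem_natBlock.2 hs),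
        h t (val_mem_natBlock.2 ht)]
    · intro h s hs
      obtain ⟨hsn, hs⟩ := mem_natBlock.1 hs
      have := congrArg Fin.val (hu (h _ hs a haV))
      rwa [coe_wordLetter, coe_wordLetter] at this
  have hcol : (∀ s ∈ natBlock V, (∀ t ∈ natBlock V, t ≤ s) → colorAt p (s + 1) = colorAt p a) ↔
      colorBefore (wordLetter p k a) = colorAfter (wordLetter p k (V.max' hV)) := by
    rw [Fin.ext_iff, coe_colorBefore, coe_colorAfter]
    constructor
    · intro h
      refine (h _ (val_mem_natBlock.2 (max'_mem V hV)) fun t ht => ?_).symm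
      obtain ⟨htn, ht⟩ := mem_natBlock.1 ht
      exact Fin.le_def.1 (le_max' V _ ht)
    · intro h s hs hmax
      obtain ⟨hsn, hs⟩ := mem_natBlock.1 hs
      have h1 : V.max' hV = ⟨s, hsn⟩ := le_antisymm
        (Fin.le_def.2 (hmax _ (val_mem_natBlock.2 (max'_mem V hV)))) (le_max' V _ hs)
      rw [h, h1]
  have hcum : freeCumulant (ν (u (wordLetter p k a).1)) V.card =
      if labelAt p a ∈ K.map Fin.valEmbedding ∨ 0 + (natBlock V).card = 2 then 1 else 0 := by
    have hmem : labelAt p a ∈ K.map Fin.valEmbedding ↔ (wordLetter p k a).1 ∈ K := by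
      rw [← coe_wordLetter]
      exact mem_map' Fin.valEmbedding
    have hc : 1 ≤ V.card := card_pos.2 hV
    rw [hcard, zero_add]
    by_cases hK : (wordLetter p k a).1 ∈ K
    · rw [hpoisson _ hK, freeCumulant_freePoissonLaw hc, if_pos (Or.inl (hmem.2 hK))]
    · rw [hsemicircle _ hK, freeCumulant_semicircleLaw hc]
      simp only [hmem, hK, false_or]
  unfold tailWeight
  rw [prod_dimVar, hcum]
  have hiff : IsAdaptedBlock p k u V hV ↔
      (∀ s ∈ natBlock V, labelAt p s = labelAt p a) ∧
        ∀ s ∈ natBlock V, (∀ t ∈ natBlock V, t ≤ s) → colorAt p (s + 1) = colorAt p a := by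
    rw [hlab, hcol]
    rfl
  by_cases h : IsAdaptedBlock p k u V hV
  · rw [if_pos h, if_pos (hiff.1 h)]
    split_ifs <;> simp
  · rw [if_neg h, if_neg (mt hiff.2 h)]

theorem monomial_sum_prod {ι σ : Type*} (s : Finset ι) (f : ι → σ →₀ ℕ) (c : ι → ℝ) :
    MvPolynomial.monomial (∑ i ∈ s, f i) (∏ i ∈ s, c i) =
      ∏ i ∈ s, MvPolynomial.monomial (f i) (c i) := by
  classical
  induction s using Finset.induction_on with
  | empty => simp
  | insert a s ha ih =>
    rw [sum_insert ha, prod_insert ha, prod_insert ha, ← ih, MvPolynomial.monomial_mul]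

/-- The weighted count is a coefficient of the total weight of `k` periods. -/
theorem weightedCount_eq_coeff {U : Type*} {u : Fin p → U} (hu : Function.Injective u)
    {ν : U → MeasureTheory.Measure ℝ} {K : Finset (Fin p)}
    (hpoisson : ∀ i ∈ K, ν (u i) = freePoissonLaw)
    (hsemicircle : ∀ i ∉ K, ν (u i) = semicircleLaw) (j : Fin (p + 1) → ℕ) :
    weightedCount p k u ν j = MvPolynomial.coeff (Finsupp.equivFunOnFinite.symm j)
      (wordSum p (K.map Fin.valEmbedding) (dimVar p) 0 (2 * p * k)) := by
  classical
  rw [wordSum, ncSum_eq_sum_finpartition, MvPolynomial.coeff_sum, weightedCount,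
    adaptedNCWithDim, adaptedNC, filter_filter, sum_filter, sum_filter]
  refine sum_congr rfl fun π _ => ?_
  have hprod : ∏ V ∈ π.parts, blockWeight p (K.map Fin.valEmbedding) (dimVar p) (natBlock V) =
      if IsColorAdapted p k π ∧ IsLabelAdapted p k u π then
        MvPolynomial.monomial (Finsupp.equivFunOnFinite.symm (dimExponent p k π))
          (∏ V ∈ π.parts.attach, freeCumulant
            (ν (u (wordLetter p k (V.1.min' (π.nonempty_of_mem_parts V.2))).1)) V.1.card)
      else 0 := by
    rw [← prod_attach, prod_congr rfl fun V _ => blockWeight_natBlock hu hpoisson hsemicircle V.1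
      (π.nonempty_of_mem_parts V.2)]
    split_ifs with h
    · rw [prod_congr rfl fun V _ => if_pos ⟨h.2 V.1 V.2, h.1 V.1 V.2⟩, ← monomial_sum_prod]
      congr 2
      ext i
      simp only [Finsupp.finsetSum_apply, Finsupp.equivFunOnFinite_symm_apply_apply, dimExponent]
      exact sum_attach π.parts fun V => blockDimExponent p k V i
    · have : ∃ V : π.parts, ¬ IsAdaptedBlock p k u V.1 (π.nonempty_of_mem_parts V.2) := by
        by_contra! hall
        exact h ⟨fun V hV => (hall ⟨V, hV⟩).2, fun V hV => (hall ⟨V, hV⟩).1⟩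
      obtain ⟨V, hV⟩ := this
      exact prod_eq_zero (mem_attach _ V) (if_neg hV)
  rw [hprod]
  by_cases hA : IsNoncrossing π
  · by_cases hB : IsColorAdapted p k π ∧ IsLabelAdapted p k u π
    · rw [if_pos hA, if_pos hB, MvPolynomial.coeff_monomial]
      refine if_congr ?_ rfl rfl
      rw [EmbeddingLike.apply_eq_iff_eq]
      exact and_iff_right ⟨hA, hB⟩
    · rw [if_pos hA, if_neg hB, MvPolynomial.coeff_zero, if_neg fun h => hB h.1.2]
  · rw [if_neg hA, if_neg fun h => hA h.1.1]

end Count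

end FussNarayana

theorem proposition6p1 {U : Type*} (p k q : ℕ) (hp : 1 ≤ p) (hk : 1 ≤ k)
    (u : Fin p → U) (hu : Function.Injective u) (ν : U → MeasureTheory.Measure ℝ)
    (K : Finset (Fin p)) (hq : K.card = q)
    (hpoisson : ∀ i ∈ K, ν (u i) = FussNarayana.freePoissonLaw)
    (hsemicircle : ∀ i ∉ K, ν (u i) = FussNarayana.semicircleLaw)
    (j : Fin (p + 1) → ℕ) :
    FussNarayana.weightedCount p k u ν j =
      1 / (k : ℝ) * (k.choose (j 0 + 1) : ℝ) * (∏ i : Fin p, (k.choose (j i.succ) : ℝ)) *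
        (FussNarayana.binom (k * q) ((∑ i, (j i : ℤ)) - (k : ℤ) * (p : ℤ)) : ℝ) := by
  open Finset FussNarayana in
  set K' : Finset ℕ := K.map Fin.valEmbedding with hK'
  set P := scaledLoopGF p K' (dimVar p) 0 with hPdef
  have hsub : K' ⊆ range p := fun x hx => by
    obtain ⟨i, -, rfl⟩ := mem_map.1 hx
    exact mem_range.2 i.2
  have hP : P = PowerSeries.X * ((1 + P) ^ q *
      ∏ c : Fin (p + 1), (PowerSeries.C (MvPolynomial.X c) + P)) := by
    have h := scaledLoopGF_functional_equation hp (fun c _ => dimVar_ne_zero p c) hsub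
    rw [← Fin.prod_univ_eq_prod_range (fun c => PowerSeries.C (dimVar p c) + _), hK', card_map,
      hq] at h
    simpa only [dimVar_coe] using h
  have hc0 : dimVar p (colorAt p 0) = MvPolynomial.X 0 := by
    rw [colorAt_of_le hp (Nat.zero_le p)]
    exact dimVar_coe 0
  have hcoeff : PowerSeries.coeff k P =
      MvPolynomial.X 0 * wordSum p K' (dimVar p) 0 (2 * p * k) := by
    rw [hPdef, scaledLoopGF, colorVar, PowerSeries.coeff_C_mul, map_sub, PowerSeries.coeff_one,
      if_neg (by omega), sub_zero, coeff_loopGF_zero, hc0]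
  rw [← coeff_solution hk hP j, hcoeff, weightedCount_eq_coeff hu hpoisson hsemicircle,
    add_comm (Finsupp.equivFunOnFinite.symm j), MvPolynomial.coeff_X_mul]
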